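/- **Setting.** Robots are points of $\mathbb R^2\cong\mathbb C$ with viewing range $1$ and without memory; each robot has a local coordinate system centred at itself, with the common unit length and handedness but an arbitrary rotation. A configuration is a finite set of points. *Drawing formations.* A drawing hull $H$ has an anchor $a$, a unit direction $d$, a span $\phi\in(0,\pi/3]$ and a diameter $\Delta\in(0,1]$; its point set is $\{x:|x-a|\le\Delta,\ \angle(d,x-a)\in[0,\phi)\}$ (counterclockwise angle in $[0,2\pi)$, with $\angle(d,0)=0$). Let $d_\perp$ be $d$ rotated counterclockwise by $\pi/2$. The $\varepsilon$-granular locations of $H$ are the points of $H$ of the form $a$ or $a+(1+2i)\varepsilon d+2j\varepsilon d_\perp$, $i,j\in\mathbb N_0$. An $\varepsilon$-granular state is a union of a set of $\varepsilon$-granular locations and a set $\{a,a+\varepsilon d,a+(1+2i)\varepsilon d\}$ with $1\le i\le\lfloor(\Delta/\varepsilon-1)/2\rfloor$; $A^\ell(\varepsilon)$ is the set of those with $\ell$ points. For fixed $\varepsilon,\Delta,\phi$, a hull $H$ of span $\phi$ and diameter $\Delta$ is an $\varepsilon$-granular drawing formation in a configuration $C$ if $C\cap H$ is an $\varepsilon$-granular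 state of $H$; it is valid if its hull is disjoint from the hull of every other $\varepsilon$-granular drawing formation in $C$. *Data of the protocol.* Let $P$ be a finite pattern of symmetricity $s$ (the largest $m$ such that $P$ splits into regular $m$-gons with a common centre, a point being a $1$-gon with arbitrary centre), with centre of symmetry $0$. Let $C^{(i)}$ be the cone of angles $[(i-1)\frac{2\pi}s,i\frac{2\pi}s)$ (with $0\in C^{(1)}$) and $P^{(1)}=P\cap C^{(1)}$. Let $\phi=\min\{2\pi/s,\pi/3\}$, $0<\Delta\le 1/6$, $\Delta\le\delta\le 1-2\Delta$ (for instance $\delta=\Delta$), and $0<\varepsilon<|p-q|$ for all distinct $p,q\in P$. Let $v_1,\dots,v_k$ be a $\delta$-drawing path of $P^{(1)}$: consecutive vertices have distance at most $1-\delta$, and every $p\in P^{(1)}$ has distance at most $1-\delta$ from some vertex. Let $\mathrm{cov}(v_j)$ be the set of $p\in P^{(1)}$ for which $j$ is the largest index with $|p-v_j|\le1-\delta$, and let the tail be the longest suffix $v_\tau,\dots,v_k$ with $\sum_{j\ge\tau}|\mathrm{cov}(v_j)|<4$. Assume that the path is compatible with the formation: - $b-a\le|A^4(\varepsilon)|$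 whenever $a<b$ and $\mathrm{cov}(v_j)=\emptyset$ for $a\le j<b$; - the tail has at most $|A^3(\varepsilon)|$ vertices; - the tail covers exactly three coordinates $p_1,p_2,p_3$, all in the closed unit ball about $v_k$. Assume further that the path starts in the point $v_1$ with polar coordinates $(2\Delta,\pi/s)$, that all $v_j\in C^{(1)}$, and that every $v_j$ has distance greater than $\max\{\varepsilon,\Delta\sin(2\pi/s)\}$ from $\partial C^{(1)}$ (no condition if $s=1$). Fix an enumeration of each $A^\ell(\varepsilon)$ that depends only on relative positions. *Intermediate shape.* Label the last three coordinates so that $p_2,p_3\ne v_k$, and fix $0<\eta\le\varepsilon/2$ such that $\mathrm{dist}(v_k,y)>\varepsilon+\eta$ for all $y\in\partial C^{(1)}$. Let $F_{inter}$ consist of $v_k$, $v_k+\eta\frac{p_2-v_k}{|p_2-v_k|}$ and $v_k+\frac\eta3\frac{p_3-v_k}{|p_3-v_k|}$. *Execution.* At stage $j\in\{1,\dots,k\}$ the first component contains one dropped robot on each coordinate of $\mathrm{cov}(v_i)$, $i<\min\{j,\tau\}$, and a drawing formation with anchor $v_j$ and direction $(1,0)$. If $j<\tau$, the formation has $\sum_{i\ge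 j}|\mathrm{cov}(v_i)|$ robots and state number $g+1$, where $g$ is the maximal number of consecutive vertices directly before $v_j$ that cover nothing. If $j\ge\tau$, it has three robots and state number $j-\tau+1$. At stage $k+1$ the drawing formation is replaced by $F_{inter}$, and from stage $k+2$ on the robots occupy $P^{(1)}$. The whole configuration consists of the $s$ rotated copies, by multiples of $2\pi/s$ about $0$, of the configuration of the first component. An execution consists of trajectories of $|P|$ robots, at pairwise distinct positions at each time, and a time $T\ge0$ such that - at each time $t<T$ all pairwise distances are at most $1$, and the configuration is not congruent (by a rotation and a translation) to that of a stage $m\ge1$; - the states required along the path exist, and at time $T+m$ ($m\ge0$) the configuration is that of stage $m+1$, up to a rotation and a translation that are fixed for the execution (so the initial drawing pattern is formed at time $T$); - from time $T$ on, dropped robots stay where they are, and each other robot stays with the formation or intermediate shape of its component or is dropped in that component. **Claim.** There is a function from sets of points to $\{\mathrm{(i)},\mathrm{(ii)},\mathrm{(iii)},\mathrm{(iv)}\}$, depending only on the data of the protocol, such that for every execution, every time $t$, every robot $r$ and every rotation of $r$'s local coordinate system, the value of the function on the set of robots within distance $1$ of $r$, expressed in that coordinate system, is (i), (ii), (iii)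 or (iv) if and only if the corresponding situation holds (in particular exactly one of them holds): 1. (i) $t<T$: $r$ is in an initial configuration, before the initial drawing pattern is formed; 2. (ii) $t\ge T$ and $r$ lies in the hull of a valid $\varepsilon$-granular drawing formation; 3. (iii) $t=T+k$ and $r$ belongs to (a rotated copy of) $F_{inter}$; 4. (iv) $r$ has been dropped: at some earlier time $t'<t$ it was in situation (ii) or (iii), and at time $t'+1$ it was in neither. -/

import Mathlib

/-! The plane is `ℂ` with its Euclidean distance; a rotation is multiplication by a complex number
of norm one.  A configuration is the set of robot positions (robots occupy distinct points). -/

noncomputable section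

/-- The counterclockwise angle in `[0, 2π)` from the direction `d` to the vector `z`
(it is `0` for `z = 0`). -/
def angleFrom (d z : ℂ) : ℝ := toIcoMod Real.two_pi_pos 0 (Complex.arg (z / d))

/-- The counterclockwise rotation by `i * 2π / s`. -/
def rot (s i : ℕ) : ℂ := Complex.exp (2 * Real.pi * Complex.I * i / s)

/-- Parameters of a drawing hull: anchor, direction, span and diameter. -/
@[ext] structure DrawingHull where
  anchor : ℂ
  dir : ℂ
  span : ℝ
  diam : ℝ

namespace DrawingHull

/-- The constraints on the parameters of a drawing hull. -/
def Legal (H : DrawingHull) : Prop :=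
  ‖H.dir‖ = 1 ∧ H.span ∈ Set.Ioc 0 (Real.pi / 3) ∧ H.diam ∈ Set.Ioc 0 1

/-- The point set of a drawing hull. -/
def points (H : DrawingHull) : Set ℂ :=
  {x | dist x H.anchor ≤ H.diam ∧ angleFrom H.dir (x - H.anchor) ∈ Set.Ico 0 H.span}

/-- The `ε`-granular locations of a hull; the vector perpendicular to `dir` is `I * dir`. -/
def granularLocations (H : DrawingHull) (ε : ℝ) : Set ℂ :=
  {z | z = H.anchor ∨ ∃ i j : ℕ, z = H.anchor + ((1 + 2 * (i : ℝ)) * ε : ℝ) * H.dir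
      + ((2 * (j : ℝ)) * ε : ℝ) * (Complex.I * H.dir)} ∩ H.points

/-- The possible placements of the three defining robots. -/
def definingSets (H : DrawingHull) (ε : ℝ) : Set (Set ℂ) :=
  {T | ∃ i ∈ Set.Icc 1 ⌊(H.diam / ε - 1) / 2⌋₊,
    T = {H.anchor, H.anchor + (ε : ℂ) * H.dir,
      H.anchor + ((1 + 2 * (i : ℝ)) * ε : ℝ) * H.dir}}

/-- The `ε`-granular states of a hull. -/
def granularStates (H : DrawingHull) (ε : ℝ) : Set (Set ℂ) :=
  {U | ∃ S ⊆ H.granularLocations ε, ∃ T ∈ H.definingSets ε, U = S ∪ T}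

/-- The `ε`-granular states with exactly `l` robots. -/
def granularStatesOfSize (H : DrawingHull) (ε : ℝ) (l : ℕ) : Set (Set ℂ) :=
  {U ∈ H.granularStates ε | U.ncard = l}

/-- In configuration `C`, the hull `H` together with all robots inside it is an `ε`-granular
drawing formation with the fixed diameter `Δ` and the fixed span `φ`. -/
def IsGranular (H : DrawingHull) (ε Δ φ : ℝ) (C : Set ℂ) : Prop :=
  H.Legal ∧ H.diam = Δ ∧ H.span = φ ∧ C ∩ H.points ∈ H.granularStates ε

/-- A valid `ε`-granular drawing formation: its hull meets the hull of no other one. -/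
def IsValid (H : DrawingHull) (ε Δ φ : ℝ) (C : Set ℂ) : Prop :=
  H.IsGranular ε Δ φ C ∧
    ∀ H' : DrawingHull, H'.IsGranular ε Δ φ C → H' ≠ H → Disjoint H.points H'.points

end DrawingHull

/-- `P` splits into regular `m`-gons centred at `c` (a single point is a `1`-gon with arbitrary
centre). -/
def IsRegularAbout (P : Finset ℂ) (c : ℂ) (m : ℕ) : Prop :=
  0 < m ∧ (m = 1 ∨ c ∉ P) ∧ ∀ z ∈ P, c + rot m 1 * (z - c) ∈ P

/-- The symmetricity of a pattern. -/
def symmetricity (P : Finset ℂ) : ℕ := sSup {m | ∃ c, IsRegularAbout P c m}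

/-- The `i`-th cone (counted from `0`) of a pattern of symmetricity `s`. -/
def cone (s i : ℕ) : Set ℂ :=
  {z | angleFrom 1 z ∈ Set.Ico (i * (2 * Real.pi / s)) ((i + 1) * (2 * Real.pi / s))}

/-- The data that fix the drawing protocol: the pattern `P`, the diameter `Δ` and granularity `ε`
of its drawing formations, the drawing path `v 1, …, v k` of the first symmetric component with its
parameter `δ`, the state enumeration `enum` (`enum l i` is the `i`-th state with `l` robots of a
hull with anchor `0` and direction `1`), and the data `p₁ p₂ p₃ η` of the intermediate shape. -/
structure DrawingProtocol where
  P : Finset ℂ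
  Δ : ℝ
  ε : ℝ
  δ : ℝ
  k : ℕ
  v : ℕ → ℂ
  enum : ℕ → ℕ → Set ℂ
  p₁ : ℂ
  p₂ : ℂ
  p₃ : ℂ
  η : ℝ

namespace DrawingProtocol

variable (X : DrawingProtocol)

/-- The symmetricity of the pattern. -/
def s : ℕ := symmetricity X.P

/-- The span of the drawing formations. -/
def φ : ℝ := min (2 * Real.pi / X.s) (Real.pi / 3)

/-- The first symmetric component. -/
def comp : Set ℂ := (X.P : Set ℂ) ∩ cone X.s 0

/-- The drawing hull with anchor `0` and direction `1`. -/
def refHull : DrawingHull := ⟨0, 1, X.φ, X.Δ⟩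

/-- The number of `ε`-granular states with `l` robots. -/
def numStates (l : ℕ) : ℕ := (X.refHull.granularStatesOfSize X.ε l).ncard

/-- The coordinates of the first component covered by `v j`: those for which `j` is the last index
of a path vertex at distance at most `1 - δ`. -/
def cov (j : ℕ) : Set ℂ :=
  {p ∈ X.comp | dist p (X.v j) ≤ 1 - X.δ ∧
    ∀ j' ∈ Set.Ioc j X.k, ¬ dist p (X.v j') ≤ 1 - X.δ}

/-- The first index of the tail, the longest suffix of the path covering fewer than four
coordinates (`k + 1` stands for the empty suffix). -/
def tailStart : ℕ :=
  sInf {a | a ∈ Set.Icc 1 (X.k + 1) ∧ ∑ j ∈ Finset.Icc a X.k, (X.cov j).ncard < 4}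

/-- The coordinates covered by the tail. -/
def covTail : Set ℂ := ⋃ j ∈ Set.Icc X.tailStart X.k, X.cov j

/-- The number of robots in each drawing formation while it is anchored in `v j`. -/
def size (j : ℕ) : ℕ :=
  if j < X.tailStart then ∑ i ∈ Finset.Icc j X.k, (X.cov i).ncard else 3

/-- The largest number of consecutive path vertices directly before `v j` that cover nothing. -/
def gap (j : ℕ) : ℕ := sSup {m | m < j ∧ ∀ i ∈ Set.Ico (j - m) j, X.cov i = ∅}

/-- The index of the state of each drawing formation while it is anchored in `v j`. -/
def stateIndex (j : ℕ) : ℕ :=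
  if j < X.tailStart then X.gap j + 1 else j - X.tailStart + 1

/-- The intermediate shape of the first component: three robots, the first at the end `v k` of the
path, the second and third displaced from `v k` by `η` and `η / 3` towards `p₂` and `p₃`. -/
def interShape : Set ℂ :=
  {X.v X.k,
    X.v X.k + (X.η / ‖X.p₂ - X.v X.k‖ : ℝ) * (X.p₂ - X.v X.k),
    X.v X.k + (X.η / 3 / ‖X.p₃ - X.v X.k‖ : ℝ) * (X.p₃ - X.v X.k)}

/-- The robots of the first component that are not yet dropped, at stage `m` of the protocol:
the drawing formation anchored in `v m` for `m ≤ k`, the intermediate shape for `m = k + 1`. -/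
def cluster (m : ℕ) : Set ℂ :=
  if m ≤ X.k then (fun z => X.v m + z) '' X.enum (X.size m) (X.stateIndex m)
  else if m = X.k + 1 then X.interShape else ∅

/-- The coordinates of the first component on which robots have been dropped before stage `m`:
the robots for `cov (v j)` are dropped when `v j` is left if `v j` is not in the tail, and the
last three are dropped when the intermediate shape is left. -/
def dropSites (m : ℕ) : Set ℂ :=
  if m ≤ X.k + 1 then ⋃ j ∈ Set.Ico 1 (min m X.tailStart), X.cov j else X.comp

/-- The configuration at stage `m ≥ 1`: the rotated copies of what happens in the first component.
Stage `1` is the initial drawing pattern, and from stage `k + 2` on the pattern is formed. -/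
def config (m : ℕ) : Set ℂ :=
  ⋃ i ∈ Set.Iio X.s, (fun z => rot X.s i * z) '' (X.dropSites m ∪ X.cluster m)

/-- The requirements on the data of the protocol. -/
structure Admissible : Prop where
  /-- The centre of symmetry of the pattern is the origin. -/
  centred : IsRegularAbout X.P 0 X.s
  diam_pos : 0 < X.Δ
  diam_le : X.Δ ≤ 1 / 6
  ε_pos : 0 < X.ε
  /-- `v` is a `δ`-drawing path of the first component. -/
  near_path : ∀ p ∈ X.comp, ∃ j ∈ Set.Icc 1 X.k, dist p (X.v j) ≤ 1 - X.δ
  step_le : ∀ j ∈ Set.Ico 1 X.k, dist (X.v j) (X.v (j + 1)) ≤ 1 - X.δ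
  /-- The path is compatible with the drawing formation. -/
  ε_lt_mindist : ∀ p ∈ X.P, ∀ q ∈ X.P, p ≠ q → X.ε < dist p q
  diam_le_δ : X.Δ ≤ X.δ
  hops_le : ∀ a ∈ Set.Icc 1 X.k, ∀ b ∈ Set.Icc 1 X.k, a < b →
    (∀ j ∈ Set.Ico a b, X.cov j = ∅) → b - a ≤ X.numStates 4
  tail_le : X.k + 1 - X.tailStart ≤ X.numStates 3
  covTail_card : X.covTail.ncard = 3
  covTail_subset : X.covTail ⊆ Metric.closedBall (X.v X.k) 1
  /-- Dropped robots stay at distance at least `Δ` from the formation that dropped them. -/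
  δ_le : X.δ ≤ 1 - 2 * X.Δ
  /-- The path starts in the anchor of the first formation of the initial drawing pattern (with
  polar coordinates `(2 * Δ, π / s)`) and lies well inside the first cone. -/
  start : X.v 1 = 2 * X.Δ * Complex.exp (Real.pi * Complex.I / X.s)
  path_mem : ∀ j ∈ Set.Icc 1 X.k, X.v j ∈ cone X.s 0
  path_inside : ∀ j ∈ Set.Icc 1 X.k, ∀ y ∈ frontier (cone X.s 0),
    max X.ε (X.Δ * Real.sin (2 * Real.pi / X.s)) < dist (X.v j) y
  /-- For each size, `enum` enumerates the states of that size. -/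
  enum_bij : ∀ l, Set.BijOn (X.enum l) (Set.Icc 1 (X.numStates l))
    (X.refHull.granularStatesOfSize X.ε l)
  /-- The intermediate shape is small, and it is built from a labelling of the last three
  coordinates in which only the first may coincide with the end of the path. -/
  covTail_eq : X.covTail = {X.p₁, X.p₂, X.p₃}
  p₂_ne : X.p₂ ≠ X.v X.k
  p₃_ne : X.p₃ ≠ X.v X.k
  η_pos : 0 < X.η
  η_le : X.η ≤ X.ε / 2
  η_inside : ∀ y ∈ frontier (cone X.s 0), X.ε + X.η < dist (X.v X.k) y

/-- An execution: `pos t r` is the position of robot `r` after `t` cycles, and `T` is the time at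
which the initial drawing pattern is formed, in the coordinate system given by the rigid motion
`z ↦ u * z + c`. -/
structure Execution where
  pos : ℕ → Fin X.P.card → ℂ
  T : ℕ
  u : ℂ
  c : ℂ
  norm_u : ‖u‖ = 1
  injective : ∀ t, Function.Injective (pos t)
  /-- Before time `T` the robots form a near-gathering ... -/
  near : ∀ t < T, ∀ r r', dist (pos t r) (pos t r') ≤ 1
  /-- ... that is not congruent to a configuration of a stage `m ≥ 1`. -/
  fresh : ∀ t < T, ∀ m, 1 ≤ m → ∀ u' c' : ℂ, ‖u'‖ = 1 →
    Set.range (pos t) ≠ (fun z => u' * z + c') '' X.config m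
  /-- The states that the formations have to adopt along the path exist. -/
  state_exists : ∀ j ∈ Set.Icc 1 X.k, X.stateIndex j ∈ Set.Icc 1 (X.numStates (X.size j))
  /-- From time `T` on, the robots go through the stages `1, 2, …`, one per cycle. -/
  run : ∀ m, Set.range (pos (T + m)) = (fun z => u * z + c) '' X.config (m + 1)
  /-- Dropped robots remain idle. -/
  idle : ∀ m r, ∀ i < X.s,
    pos (T + m) r ∈ (fun z => u * (rot X.s i * z) + c) '' X.dropSites (m + 1) →
    pos (T + m + 1) r = pos (T + m) r
  /-- The other robots stay with their cluster or are dropped in their component. -/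
  stay : ∀ m r, ∀ i < X.s,
    pos (T + m) r ∈ (fun z => u * (rot X.s i * z) + c) '' X.cluster (m + 1) →
    pos (T + m + 1) r ∈
      (fun z => u * (rot X.s i * z) + c) '' (X.cluster (m + 2) ∪ X.dropSites (m + 2))

end DrawingProtocol

/-- The four situations of a robot. -/
inductive Situation
  | initial
  | drawing
  | intermediate
  | dropped

namespace DrawingProtocol.Execution

variable {X : DrawingProtocol} (E : X.Execution)

/-- What robot `r` sees at time `t`: all robots at distance at most `1`, in a local coordinate
system centred at `r` and rotated by `w`. -/
def snapshot (t : ℕ) (r : Fin X.P.card) (w : ℂ) : Set ℂ :=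
  {z | ∃ r', dist (E.pos t r') (E.pos t r) ≤ 1 ∧ z = w * (E.pos t r' - E.pos t r)}

/-- The initial drawing pattern is not yet formed. -/
def InInitial (t : ℕ) : Prop := t < E.T

/-- The initial drawing pattern has been formed and `r` lies in the hull of a valid `ε`-granular
drawing formation. -/
def InDrawing (t : ℕ) (r : Fin X.P.card) : Prop :=
  E.T ≤ t ∧ ∃ H : DrawingHull, H.IsValid X.ε X.Δ X.φ (Set.range (E.pos t)) ∧ E.pos t r ∈ H.points

/-- The formations have been replaced by their intermediate shapes, and `r` is in one of them. -/
def InIntermediate (t : ℕ) (r : Fin X.P.card) : Prop :=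
  t = E.T + X.k ∧ ∃ i < X.s,
    E.pos t r ∈ (fun z => E.u * (rot X.s i * z) + E.c) '' X.interShape

/-- `r` has been dropped: in an earlier cycle it left a drawing formation or an intermediate
shape without being in one afterwards. -/
def IsDropped (t : ℕ) (r : Fin X.P.card) : Prop :=
  ∃ t' < t, (E.InDrawing t' r ∨ E.InIntermediate t' r) ∧
    ¬ (E.InDrawing (t' + 1) r ∨ E.InIntermediate (t' + 1) r)

/-- Robot `r` is at time `t` in the given situation. -/
def InSituation (t : ℕ) (r : Fin X.P.card) : Situation → Prop
  | .initial => E.InInitial t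
  | .drawing => E.InDrawing t r
  | .intermediate => E.InIntermediate t r
  | .dropped => E.IsDropped t r

end DrawingProtocol.Execution

end

theorem angleFrom_nonneg (d z : ℂ) : 0 ≤ angleFrom d z :=
  (toIcoMod_mem_Ico Real.two_pi_pos 0 _).1

theorem angleFrom_lt_two_pi (d z : ℂ) : angleFrom d z < 2 * Real.pi := by
  simpa [angleFrom] using (toIcoMod_mem_Ico Real.two_pi_pos 0 (Complex.arg (z / d))).2

theorem angleFrom_mul_left {u : ℂ} (hu : u ≠ 0) (d z : ℂ) :
    angleFrom (u * d) (u * z) = angleFrom d z := by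
  rw [angleFrom, angleFrom, mul_div_mul_left _ _ hu]

theorem angleFrom_ofReal_mul {d : ℂ} (hd : d ≠ 0) {x : ℝ} (hx : 0 ≤ x) :
    angleFrom d (x * d) = 0 := by
  rw [angleFrom, mul_div_cancel_right₀ _ hd, Complex.arg_ofReal_of_nonneg hx]
  simp

theorem norm_mul_exp_angleFrom (z : ℂ) :
    (‖z‖ : ℂ) * Complex.exp (angleFrom 1 z * Complex.I) = z := by
  have h : (angleFrom 1 z : ℝ) = Complex.arg z -
      (toIcoDiv Real.two_pi_pos 0 (Complex.arg z) : ℝ) * (2 * Real.pi) := by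
    rw [angleFrom, toIcoMod, zsmul_eq_mul, div_one]
  rw [h]
  conv_rhs => rw [← Complex.norm_mul_exp_arg_mul_I z]
  congr 1
  rw [Complex.exp_eq_exp_iff_exists_int]
  refine ⟨-toIcoDiv Real.two_pi_pos 0 (Complex.arg z), ?_⟩
  push_cast
  ring

theorem mem_cone_zero {s : ℕ} {z : ℂ} : z ∈ cone s 0 ↔ angleFrom 1 z < 2 * Real.pi / s := by
  simp [cone, angleFrom_nonneg]

theorem cone_one_zero : cone 1 0 = Set.univ := by
  ext z
  simp [mem_cone_zero, angleFrom_lt_two_pi]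

theorem norm_rot (s i : ℕ) : ‖rot s i‖ = 1 := by
  have : (2 * Real.pi * Complex.I * i / s : ℂ) = ((2 * Real.pi * i / s : ℝ) : ℂ) * Complex.I := by
    push_cast; ring
  rw [rot, this, Complex.norm_exp_ofReal_mul_I]

theorem rot_ne_zero (s i : ℕ) : rot s i ≠ 0 := Complex.exp_ne_zero _

theorem rot_zero (s : ℕ) : rot s 0 = 1 := by simp [rot]

theorem rot_succ (s i : ℕ) : rot s (i + 1) = rot s 1 * rot s i := by
  rw [rot, rot, rot, ← Complex.exp_add]
  congr 1
  push_cast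
  ring

/-- The rotated copies of the first cone only meet in the origin. -/
theorem eq_of_rot_mul_eq {s i j : ℕ} (hi : i < s) (hj : j < s) {x y : ℂ}
    (hx : x ∈ cone s 0) (hy : y ∈ cone s 0) (h : rot s i * x = rot s j * y) (hx0 : x ≠ 0) :
    i = j := by
  have hs : (0 : ℝ) < s := by exact_mod_cast (Nat.zero_le i).trans_lt hi
  rw [mem_cone_zero] at hx hy
  have hn : ‖x‖ = ‖y‖ := by simpa [norm_rot] using congrArg norm h
  rw [← norm_mul_exp_angleFrom x, ← norm_mul_exp_angleFrom y, ← hn] at h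
  have hxn : (‖x‖ : ℂ) ≠ 0 := by simpa using hx0
  have h' : Complex.exp (2 * Real.pi * Complex.I * i / s + angleFrom 1 x * Complex.I) =
      Complex.exp (2 * Real.pi * Complex.I * j / s + angleFrom 1 y * Complex.I) := by
    rw [Complex.exp_add, Complex.exp_add]
    apply mul_left_cancel₀ hxn
    simp only [rot] at h
    linear_combination h
  obtain ⟨n, hn⟩ := Complex.exp_eq_exp_iff_exists_int.1 h'
  have hr : 2 * Real.pi * i / s + angleFrom 1 x =
      2 * Real.pi * j / s + angleFrom 1 y + n * (2 * Real.pi) := by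
    have := congrArg Complex.im hn
    have e1 : ∀ (l : ℕ) (θ : ℝ), (2 * Real.pi * Complex.I * l / s + θ * Complex.I : ℂ) =
        ((2 * Real.pi * l / s + θ : ℝ) : ℂ) * Complex.I := by
      intro l θ; push_cast; ring
    have e2 : (n * (2 * Real.pi * Complex.I) : ℂ) = ((n * (2 * Real.pi) : ℝ) : ℂ) * Complex.I := by
      push_cast; ring
    rw [e1, e1, e2] at this
    simpa using this
  have hx1 := angleFrom_nonneg 1 x
  have hy1 := angleFrom_nonneg 1 y
  have hα : 0 < 2 * Real.pi / s := div_pos Real.two_pi_pos hs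
  have key : ((i : ℤ) - j - n * s : ℤ) * (2 * Real.pi / s) = angleFrom 1 y - angleFrom 1 x := by
    push_cast
    have : (n : ℝ) * s * (2 * Real.pi / s) = n * (2 * Real.pi) := by
      field_simp
    have e : ((i : ℝ) - j - n * s) * (2 * Real.pi / s) =
      2 * Real.pi * i / s - 2 * Real.pi * j / s - n * s * (2 * Real.pi / s) := by ring
    rw [e, this]
    linarith
  have k1 : ((i : ℤ) - j - n * s : ℤ) < 1 := by
    have : (((i : ℤ) - j - n * s : ℤ) : ℝ) < 1 := by
      by_contra hc
      push Not at hc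
      nlinarith
    exact_mod_cast this
  have k2 : -1 < ((i : ℤ) - j - n * s : ℤ) := by
    have : (-1 : ℝ) < (((i : ℤ) - j - n * s : ℤ) : ℝ) := by
      by_contra hc
      push Not at hc
      nlinarith
    exact_mod_cast this
  have k3 : (i : ℤ) - j = n * s := by omega
  have hn0 : n = 0 := by
    by_contra hn0
    rcases lt_or_gt_of_ne hn0 with h0 | h0
    · have : n * s ≤ -1 * (s : ℤ) := by gcongr; omega
      omega
    · have : 1 * (s : ℤ) ≤ n * s := by gcongr; omega
      omega
  rw [hn0] at k3
  omega

theorem two_pi_div_mem_Ioc {s : ℕ} (hs : 2 ≤ s) : 2 * Real.pi / s ∈ Set.Ioc 0 Real.pi := by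
  have h2 : (2 : ℝ) ≤ s := by exact_mod_cast hs
  refine ⟨by positivity, ?_⟩
  rw [div_le_iff₀ (by linarith)]
  nlinarith [Real.pi_pos]

theorem mem_cone_zero_iff {s : ℕ} (hs : 2 ≤ s) {z : ℂ} :
    z ∈ cone s 0 ↔ z = 0 ∨ (0 < z.re ∧ z.im = 0) ∨
      (0 < z.im ∧ z.im * Real.cos (2 * Real.pi / s) < z.re * Real.sin (2 * Real.pi / s)) := by
  obtain ⟨h0, hπ⟩ := two_pi_div_mem_Ioc hs
  rw [mem_cone_zero]
  have hz := norm_mul_exp_angleFrom z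
  have ha := angleFrom_nonneg 1 z
  have ha' := angleFrom_lt_two_pi 1 z
  generalize 2 * Real.pi / s = α at *
  have hre : z.re = ‖z‖ * Real.cos (angleFrom 1 z) := by
    conv_lhs => rw [← hz]
    rw [Complex.re_ofReal_mul, Complex.exp_ofReal_mul_I_re]
  have him : z.im = ‖z‖ * Real.sin (angleFrom 1 z) := by
    conv_lhs => rw [← hz]
    rw [Complex.im_ofReal_mul, Complex.exp_ofReal_mul_I_im]
  have hsub : z.re * Real.sin α - z.im * Real.cos α = ‖z‖ * Real.sin (α - angleFrom 1 z) := by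
    rw [hre, him, Real.sin_sub]; ring
  constructor
  · intro h
    rcases eq_or_ne z 0 with rfl | hz0
    · exact Or.inl rfl
    have hn : 0 < ‖z‖ := norm_pos_iff.2 hz0
    rcases ha.eq_or_lt with h1 | h1
    · right; left
      rw [hre, him, ← h1]
      simpa using hz0
    · right; right
      refine ⟨him ▸ mul_pos hn (Real.sin_pos_of_pos_of_lt_pi h1 (by linarith)), ?_⟩
      have := mul_pos hn (Real.sin_pos_of_pos_of_lt_pi (x := α - angleFrom 1 z)
        (by linarith) (by linarith))
      linarith
  · rintro (rfl | ⟨h1, h2⟩ | ⟨h1, h2⟩)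
    · simpa [angleFrom] using h0
    · have : z = ((z.re : ℝ) : ℂ) * 1 := by
        apply Complex.ext <;> simp [h2]
      rw [this, angleFrom_ofReal_mul one_ne_zero h1.le]
      exact h0
    · by_contra hc
      push Not at hc
      have hn : 0 < ‖z‖ := norm_pos_iff.2 (by rintro rfl; simp at h1)
      have hsin : 0 < Real.sin (angleFrom 1 z) := by
        by_contra h; push Not at h; nlinarith
      have hlt : angleFrom 1 z < Real.pi := by
        by_contra h
        push Not at h
        have := Real.sin_nonneg_of_nonneg_of_le_pi (x := angleFrom 1 z - Real.pi)
          (by linarith) (by linarith)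
        rw [Real.sin_sub_pi] at this
        linarith
      have := Real.sin_nonneg_of_nonneg_of_le_pi (x := angleFrom 1 z - α)
          (by linarith) (by linarith)
      have h3 : Real.sin (α - angleFrom 1 z) ≤ 0 := by
        rw [← neg_sub, Real.sin_neg]; linarith
      nlinarith

theorem add_mem_cone_zero {s : ℕ} (hs : 0 < s) {z w : ℂ} (hz : z ∈ cone s 0)
    (hw : w ∈ cone s 0) : z + w ∈ cone s 0 := by
  rcases (show s = 1 ∨ 2 ≤ s by omega) with rfl | hs
  · simp [cone_one_zero]
  obtain ⟨h0, hπ⟩ := two_pi_div_mem_Ioc hs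
  have hsin := Real.sin_nonneg_of_nonneg_of_le_pi h0.le hπ
  rw [mem_cone_zero_iff hs] at *
  rcases hz with rfl | ⟨z1, z2⟩ | ⟨z1, z2⟩
  · simpa using hw
  · rcases hw with rfl | ⟨w1, w2⟩ | ⟨w1, w2⟩
    · exact Or.inr (Or.inl (by simp [z1, z2]))
    · exact Or.inr (Or.inl (by simp [z2, w2]; linarith))
    · refine Or.inr (Or.inr ?_)
      rw [Complex.add_re, Complex.add_im, z2]
      exact ⟨by linarith, by nlinarith [mul_nonneg z1.le hsin]⟩
  · rcases hw with rfl | ⟨w1, w2⟩ | ⟨w1, w2⟩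
    · exact Or.inr (Or.inr (by simpa using ⟨z1, z2⟩))
    · refine Or.inr (Or.inr ?_)
      rw [Complex.add_re, Complex.add_im, w2]
      exact ⟨by linarith, by nlinarith [mul_nonneg w1.le hsin]⟩
    · refine Or.inr (Or.inr ?_)
      rw [Complex.add_re, Complex.add_im]
      exact ⟨by linarith, by nlinarith⟩

theorem add_mem_interior_cone {s : ℕ} (hs : 0 < s) {z w : ℂ} (hz : z ∈ interior (cone s 0))
    (hw : w ∈ cone s 0) : z + w ∈ interior (cone s 0) := by
  obtain ⟨r, hr, hball⟩ := Metric.mem_nhds_iff.1 (mem_interior_iff_mem_nhds.1 hz)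
  refine mem_interior_iff_mem_nhds.2 (Metric.mem_nhds_iff.2 ⟨r, hr, fun y hy => ?_⟩)
  have : y - w ∈ cone s 0 := hball (by
    rw [Metric.mem_ball, dist_eq_norm] at hy ⊢
    convert hy using 2; ring)
  simpa using add_mem_cone_zero hs this hw

theorem im_pos_of_mem_interior_cone {s : ℕ} (hs : 2 ≤ s) {z : ℂ}
    (hz : z ∈ interior (cone s 0)) : 0 < z.im := by
  obtain ⟨r, hr, hball⟩ := Metric.mem_nhds_iff.1 (mem_interior_iff_mem_nhds.1 hz)
  have hm : z - (r / 2 : ℝ) * Complex.I ∈ cone s 0 := hball (by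
    rw [Metric.mem_ball, dist_eq_norm]
    simp [abs_of_pos hr, hr])
  have him : (z - (r / 2 : ℝ) * Complex.I).im = z.im - r / 2 := by simp
  rw [mem_cone_zero_iff hs] at hm
  rcases hm with h | ⟨-, h⟩ | ⟨h, -⟩
  · have := congrArg Complex.im h
    rw [him] at this
    simp at this
    linarith
  all_goals linarith

/-- A ball around a point of the cone that avoids the frontier lies in the interior. -/
theorem closedBall_subset_interior {S : Set ℂ} {v : ℂ} {r : ℝ} (hr : 0 ≤ r) (hv : v ∈ S)
    (h : ∀ y ∈ frontier S, r < dist v y) : Metric.closedBall v r ⊆ interior S := by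
  have hd : ∀ y ∈ Metric.closedBall v r, y ∉ frontier S := fun y hy hf => by
    have := h y hf
    rw [Metric.mem_closedBall, dist_comm] at hy
    linarith
  have hsub : Metric.closedBall v r ⊆ interior S ∪ (closure S)ᶜ := fun y hy => by
    have := hd y hy
    rw [frontier, Set.mem_sdiff, not_and_or, not_not] at this
    exact this.symm
  refine (convex_closedBall v r).isPreconnected.subset_left_of_subset_union isOpen_interior
    isClosed_closure.isOpen_compl ?_ hsub ⟨v, Metric.mem_closedBall_self hr, ?_⟩
  · exact Set.disjoint_compl_right_iff_subset.2 interior_subset_closure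
  · rcases hsub (Metric.mem_closedBall_self hr) with h | h
    · exact h
    · exact absurd (subset_closure hv) h

theorem sub_ofReal_mem_cone {s : ℕ} (hs : 0 < s) {v : ℂ} {D x : ℝ} (hx : 0 ≤ x) (hxD : x ≤ D)
    (h : Metric.closedBall v (D * Real.sin (2 * Real.pi / s)) ⊆ interior (cone s 0))
    (hv : v ∈ interior (cone s 0)) : v - x ∈ cone s 0 := by
  rcases (show s = 1 ∨ 2 ≤ s by omega) with rfl | hs
  · simp [cone_one_zero]
  obtain ⟨h0, hπ⟩ := two_pi_div_mem_Ioc hs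
  have hsin := Real.sin_nonneg_of_nonneg_of_le_pi h0.le hπ
  have hsc := Real.sin_sq_add_cos_sq (2 * Real.pi / s)
  set a := Real.sin (2 * Real.pi / s)
  set b := Real.cos (2 * Real.pi / s)
  have hb : v + (x * a : ℝ) * (⟨-a, b⟩ : ℂ) ∈ interior (cone s 0) := by
    refine h ?_
    have hn : ‖(⟨-a, b⟩ : ℂ)‖ = 1 := by
      rw [Complex.norm_def, Complex.normSq_mk, Real.sqrt_eq_one]
      linarith
    rw [Metric.mem_closedBall, dist_eq_norm, add_sub_cancel_left, norm_mul, hn, mul_one,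
      Complex.norm_real, Real.norm_of_nonneg (mul_nonneg hx hsin)]
    exact mul_le_mul_of_nonneg_right hxD hsin
  have him := im_pos_of_mem_interior_cone hs hb
  have hm := interior_subset hb
  rw [mem_cone_zero_iff hs] at hm ⊢
  have e1 : (v + (x * a : ℝ) * (⟨-a, b⟩ : ℂ)).re = v.re - x * a * a := by
    rw [Complex.add_re, Complex.re_ofReal_mul]; ring
  have e2 : (v + (x * a : ℝ) * (⟨-a, b⟩ : ℂ)).im = v.im + x * a * b := by
    rw [Complex.add_im, Complex.im_ofReal_mul]
  rcases hm with h | ⟨-, h⟩ | ⟨-, h⟩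
  · rw [h, Complex.zero_im] at him
    exact absurd him (lt_irrefl _)
  · exact absurd h him.ne'
  · refine Or.inr (Or.inr ⟨by simpa using im_pos_of_mem_interior_cone hs hv, ?_⟩)
    rw [e1, e2] at h
    simp only [Complex.sub_re, Complex.sub_im, Complex.ofReal_re, Complex.ofReal_im, sub_zero]
    have : x * a * (a ^ 2 + b ^ 2) = x * a := by rw [hsc, mul_one]
    nlinarith

theorem dist_rigid {u : ℂ} (hu : ‖u‖ = 1) (c x y : ℂ) :
    dist (u * x + c) (u * y + c) = dist x y := by
  rw [dist_add_right, dist_eq_norm, ← mul_sub, norm_mul, hu, one_mul, dist_eq_norm]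

theorem rigid_injective {u : ℂ} (hu : ‖u‖ = 1) (c : ℂ) :
    Function.Injective fun z : ℂ => u * z + c := fun x y h => by
  rw [← dist_eq_zero, ← dist_rigid hu c, dist_eq_zero]
  exact h

theorem ne_zero_of_norm_eq_one {u : ℂ} (hu : ‖u‖ = 1) : u ≠ 0 := by
  rintro rfl
  simp at hu

namespace DrawingHull

/-- The image of a hull under the rigid motion `z ↦ u * z + c`. -/
def map (H : DrawingHull) (u c : ℂ) : DrawingHull := ⟨u * H.anchor + c, u * H.dir, H.span, H.diam⟩

variable {H : DrawingHull} {ε Δ φ : ℝ} {C C' : Set ℂ} {u c : ℂ}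

theorem map_map (H : DrawingHull) (u c u' c' : ℂ) :
    (H.map u c).map u' c' = H.map (u' * u) (u' * c + c') := by
  simp only [map, DrawingHull.mk.injEq, and_true]
  constructor <;> ring

theorem map_one_zero (H : DrawingHull) : H.map 1 0 = H := by simp [map]

theorem mem_points_map (hu : ‖u‖ = 1) {x : ℂ} :
    u * x + c ∈ (H.map u c).points ↔ x ∈ H.points := by
  have hd : u * x + c - (u * H.anchor + c) = u * (x - H.anchor) := by ring
  simp only [points, map, Set.mem_ofPred_eq, hd, dist_rigid hu,
    angleFrom_mul_left (ne_zero_of_norm_eq_one hu)]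

theorem points_map (hu : ‖u‖ = 1) : (H.map u c).points = (fun z => u * z + c) '' H.points := by
  have h0 := ne_zero_of_norm_eq_one hu
  ext x
  constructor
  · intro hx
    have hxe : u * (u⁻¹ * (x - c)) + c = x := by field_simp; ring
    exact ⟨u⁻¹ * (x - c), (mem_points_map hu).1 (hxe.symm ▸ hx), hxe⟩
  · rintro ⟨y, hy, rfl⟩
    exact (mem_points_map hu).2 hy

theorem image_mem_granularStates (hu : ‖u‖ = 1) {U : Set ℂ} (hU : U ∈ H.granularStates ε) :
    (fun z => u * z + c) '' U ∈ (H.map u c).granularStates ε := by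
  obtain ⟨S, hS, T, ⟨i, hi, rfl⟩, rfl⟩ := hU
  refine ⟨(fun z => u * z + c) '' S, ?_, _, ⟨i, hi, rfl⟩, ?_⟩
  · rintro _ ⟨z, hz, rfl⟩
    obtain ⟨h1, h2⟩ := hS hz
    refine ⟨?_, (mem_points_map hu).2 h2⟩
    rcases h1 with rfl | ⟨i, j, rfl⟩
    · exact Or.inl rfl
    · refine Or.inr ⟨i, j, ?_⟩
      simp only [map]
      ring
  · rw [Set.image_union]
    have e : ∀ x : ℂ, u * (H.anchor + x * H.dir) + c = u * H.anchor + c + x * (u * H.dir) :=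
      fun x => by ring
    simp only [Set.image_insert_eq, Set.image_singleton, map, e]

theorem IsGranular.map (hu : ‖u‖ = 1) (h : H.IsGranular ε Δ φ C) :
    (H.map u c).IsGranular ε Δ φ ((fun z => u * z + c) '' C) := by
  obtain ⟨⟨h1, h2, h3⟩, h4, h5, h6⟩ := h
  refine ⟨⟨by simp [DrawingHull.map, hu, h1], h2, h3⟩, h4, h5, ?_⟩
  rw [points_map hu, ← Set.image_inter (rigid_injective hu c)]
  exact image_mem_granularStates hu h6

theorem IsGranular.exists_of_image (hu : ‖u‖ = 1)
    (h : H.IsGranular ε Δ φ ((fun z => u * z + c) '' C)) :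
    ∃ H₀ : DrawingHull, H₀.IsGranular ε Δ φ C ∧ H = H₀.map u c := by
  have h0 := ne_zero_of_norm_eq_one hu
  refine ⟨H.map u⁻¹ (-(u⁻¹ * c)), ?_, ?_⟩
  · have := h.map (u := u⁻¹) (c := -(u⁻¹ * c)) (by simp [hu])
    rw [Set.image_image] at this
    convert this
    conv_lhs => rw [← Set.image_id C]
    refine Set.image_congr fun z _ => ?_
    simp only [id]
    field_simp
    ring
  · rw [map_map, mul_inv_cancel₀ h0]
    have : u * -(u⁻¹ * c) + c = 0 := by field_simp; ring
    rw [this, map_one_zero]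

theorem IsGranular.congr (h : H.IsGranular ε Δ φ C) (hC : C' ∩ H.points = C ∩ H.points) :
    H.IsGranular ε Δ φ C' := by
  obtain ⟨h1, h2, h3, h4⟩ := h
  exact ⟨h1, h2, h3, hC ▸ h4⟩

theorem dist_le_of_mem_points {x y : ℂ} (hx : x ∈ H.points) (hy : y ∈ H.points) :
    dist x y ≤ 2 * H.diam := by
  have := dist_triangle_right x y H.anchor
  linarith [hx.1, hy.1]

/-- The last of the defining robots lies in the hull. -/
theorem mul_le_diam_of_mem_Icc (hε : 0 < ε) {i : ℕ}
    (hi : i ∈ Set.Icc 1 ⌊(H.diam / ε - 1) / 2⌋₊) : (1 + 2 * (i : ℝ)) * ε ≤ H.diam := by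
  have h1 : ⌊(H.diam / ε - 1) / 2⌋₊ ≠ 0 := by
    have := hi.1.trans hi.2
    omega
  have h2 := (Nat.le_floor_iff' (by have := hi.1; omega)).1 hi.2
  rw [← le_div_iff₀ hε]
  linarith

theorem IsGranular.exists_defining (hε : 0 < ε) (h : H.IsGranular ε Δ φ C) :
    ∃ n : ℕ, 1 ≤ n ∧ (1 + 2 * (n : ℝ)) * ε ≤ Δ ∧ H.anchor ∈ C ∧ H.anchor + ε * H.dir ∈ C ∧
      H.anchor + ((1 + 2 * (n : ℝ)) * ε : ℝ) * H.dir ∈ C := by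
  obtain ⟨h1, rfl, h3, S, hS, T, ⟨i, hi, rfl⟩, hU⟩ := h
  have hsub : {H.anchor, H.anchor + (ε : ℂ) * H.dir,
      H.anchor + ((1 + 2 * (i : ℝ)) * ε : ℝ) * H.dir} ⊆ C := fun x hx =>
    (hU.symm ▸ Or.inr hx : x ∈ C ∩ H.points).1
  exact ⟨i, hi.1, mul_le_diam_of_mem_Icc hε hi, hsub (by simp), hsub (by simp), hsub (by simp)⟩

theorem anchor_add_mem_points (hd : ‖H.dir‖ = 1) (hφ : 0 < H.span) {x : ℝ} (hx : 0 ≤ x)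
    (hxd : x ≤ H.diam) : H.anchor + x * H.dir ∈ H.points := by
  have h0 := ne_zero_of_norm_eq_one hd
  refine ⟨?_, ?_⟩
  · simpa [dist_eq_norm, hd, abs_of_nonneg hx] using hxd
  · rw [add_sub_cancel_left, angleFrom_ofReal_mul h0 hx]
    exact ⟨le_rfl, hφ⟩

theorem subset_granularLocations (hd : ‖H.dir‖ = 1) (hφ : 0 < H.span) (hε : 0 < ε) {U : Set ℂ}
    (hU : U ∈ H.granularStates ε) : U ⊆ H.granularLocations ε := by
  obtain ⟨S, hS, T, ⟨i, hi, rfl⟩, rfl⟩ := hU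
  have hle := mul_le_diam_of_mem_Icc hε hi
  have h1 : (0 : ℝ) ≤ i := by positivity
  have h2 : ε ≤ H.diam := by nlinarith
  refine Set.union_subset hS ?_
  rintro x (rfl | rfl | rfl)
  · refine ⟨Or.inl rfl, ?_⟩
    simpa using anchor_add_mem_points hd hφ le_rfl (hε.le.trans h2)
  · exact ⟨Or.inr ⟨0, 0, by simp⟩, anchor_add_mem_points hd hφ hε.le h2⟩
  · exact ⟨Or.inr ⟨i, 0, by simp⟩, anchor_add_mem_points hd hφ (by positivity) hle⟩

end DrawingHull

/-- A pair of granular locations at distance `ε` consists of the anchor and its successor. -/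
theorem eq_or_eq_of_dist_eq {ε : ℝ} (hε : 0 < ε) {H : DrawingHull} (ha : H.anchor = 0)
    (hd : H.dir = 1) {z w : ℂ} (hz : z ∈ H.granularLocations ε) (hw : w ∈ H.granularLocations ε)
    (h : dist z w = ε) : (z = 0 ∧ w = ε) ∨ (z = ε ∧ w = 0) := by
  have loc : ∀ x ∈ H.granularLocations ε,
      x = 0 ∨ ∃ i j : ℕ, x = ⟨(1 + 2 * i) * ε, 2 * j * ε⟩ := by
    rintro x ⟨hx | ⟨i, j, hx⟩, -⟩
    · exact Or.inl (hx.trans ha)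
    · refine Or.inr ⟨i, j, ?_⟩
      rw [hx, ha, hd]
      apply Complex.ext <;> simp
  have first : ∀ i j : ℕ, ‖(⟨(1 + 2 * i) * ε, 2 * j * ε⟩ : ℂ)‖ = ε →
      (⟨(1 + 2 * i) * ε, 2 * j * ε⟩ : ℂ) = ε := by
    intro i j h
    have h2 := congrArg (· ^ 2) h
    simp only [Complex.sq_norm, Complex.normSq_mk] at h2
    have h3 : (((1 + 2 * i) ^ 2 + (2 * j) ^ 2 : ℕ) : ℝ) = (1 : ℕ) := by
      have : 0 < ε ^ 2 := by positivity
      push_cast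
      apply mul_right_cancel₀ this.ne'
      linarith
    have h4 : (1 + 2 * i) ^ 2 + (2 * j) ^ 2 = 1 := by exact_mod_cast h3
    have hi : i = 0 := by nlinarith
    have hj : j = 0 := by nlinarith
    subst hi hj
    apply Complex.ext <;> simp
  rcases loc z hz with rfl | ⟨i, j, rfl⟩
  · rcases loc w hw with rfl | ⟨i, j, rfl⟩
    · simp at h
      exact absurd h hε.ne
    · rw [dist_zero_left] at h
      exact Or.inl ⟨rfl, first i j h⟩
  · rcases loc w hw with rfl | ⟨i', j', rfl⟩
    · rw [dist_zero_right] at h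
      exact Or.inr ⟨first i j h, rfl⟩
    · exfalso
      rw [dist_eq_norm] at h
      have h2 := congrArg (· ^ 2) h
      simp only [Complex.sq_norm, Complex.normSq_apply, Complex.sub_re, Complex.sub_im] at h2
      have h3 : ((4 * (((i : ℤ) - i') ^ 2 + ((j : ℤ) - j') ^ 2) : ℤ) : ℝ) = (1 : ℤ) := by
        have : 0 < ε ^ 2 := by positivity
        push_cast
        apply mul_right_cancel₀ this.ne'
        linarith
      have h4 : 4 * (((i : ℤ) - i') ^ 2 + ((j : ℤ) - j') ^ 2) = 1 := by exact_mod_cast h3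
      omega

namespace DrawingProtocol

variable {X : DrawingProtocol}

/-- The rotated copies of the coordinates on which robots have been dropped before stage `m`. -/
def droppedPart (X : DrawingProtocol) (m : ℕ) : Set ℂ :=
  ⋃ i ∈ Set.Iio X.s, (fun z => rot X.s i * z) '' X.dropSites m

/-- The rotated copies of the cluster at stage `m`. -/
def clusterPart (X : DrawingProtocol) (m : ℕ) : Set ℂ :=
  ⋃ i ∈ Set.Iio X.s, (fun z => rot X.s i * z) '' X.cluster m

theorem mem_droppedPart {m : ℕ} {x : ℂ} :
    x ∈ X.droppedPart m ↔ ∃ i < X.s, ∃ p ∈ X.dropSites m, rot X.s i * p = x := by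
  simp [droppedPart]

theorem mem_clusterPart {m : ℕ} {x : ℂ} :
    x ∈ X.clusterPart m ↔ ∃ i < X.s, ∃ p ∈ X.cluster m, rot X.s i * p = x := by
  simp [clusterPart]

theorem config_eq (m : ℕ) : X.config m = X.droppedPart m ∪ X.clusterPart m := by
  simp only [config, droppedPart, clusterPart, Set.image_union, Set.iUnion_union_distrib]

theorem dist_rot_mul (s i : ℕ) (x y : ℂ) : dist (rot s i * x) (rot s i * y) = dist x y := by
  simpa using dist_rigid (norm_rot s i) 0 x y

/-- The states required along the path exist. -/
def StatesExist (X : DrawingProtocol) : Prop :=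
  ∀ j ∈ Set.Icc 1 X.k, X.stateIndex j ∈ Set.Icc 1 (X.numStates (X.size j))

/-- The hull of the drawing formation of the `i`-th component at stage `m`. -/
noncomputable def hullAt (X : DrawingProtocol) (m i : ℕ) : DrawingHull :=
  X.refHull.map (rot X.s i) (rot X.s i * X.v m)

theorem cov_subset_comp (j : ℕ) : X.cov j ⊆ X.comp := fun _ hp => hp.1

theorem dropSites_subset_comp (m : ℕ) : X.dropSites m ⊆ X.comp := by
  unfold dropSites
  split_ifs
  · exact Set.iUnion₂_subset fun j _ => cov_subset_comp j
  · exact subset_rfl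

theorem dropSites_mono_succ (m : ℕ) : X.dropSites m ⊆ X.dropSites (m + 1) := by
  by_cases h : m + 1 ≤ X.k + 1
  · rw [dropSites, dropSites, if_pos h, if_pos (by omega)]
    refine Set.biUnion_subset_biUnion_left fun j hj => ⟨hj.1, hj.2.trans_le ?_⟩
    exact min_le_min_right _ (Nat.le_succ m)
  · rw [dropSites.eq_1 X (m + 1), if_neg h]
    exact dropSites_subset_comp m

theorem droppedPart_mono_succ (m : ℕ) : X.droppedPart m ⊆ X.droppedPart (m + 1) :=
  Set.iUnion₂_mono fun _ _ => Set.image_mono (dropSites_mono_succ m)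

theorem droppedPart_one : X.droppedPart 1 = ∅ := by
  have : X.dropSites 1 = ∅ := by
    rw [dropSites, if_pos (by omega)]
    simp only [Set.iUnion_eq_empty]
    intro j hj
    have := hj.1.trans_lt (hj.2.trans_le (min_le_left _ _))
    omega
  simp [droppedPart, this]

theorem clusterPart_eq_empty {m : ℕ} (h : X.k + 1 < m) : X.clusterPart m = ∅ := by
  have : X.cluster m = ∅ := by
    rw [cluster, if_neg (by omega), if_neg (by omega)]
  simp [clusterPart, this]

theorem cluster_inter : X.cluster (X.k + 1) = X.interShape := by
  rw [cluster, if_neg (by omega), if_pos rfl]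

theorem tailStart_mem (X : DrawingProtocol) : X.tailStart ∈ Set.Icc 1 (X.k + 1) := by
  have : X.tailStart ∈ {a | a ∈ Set.Icc 1 (X.k + 1) ∧
      ∑ j ∈ Finset.Icc a X.k, (X.cov j).ncard < 4} :=
    Nat.sInf_mem ⟨X.k + 1, by simp⟩
  exact this.1

theorem mem_cone_of_mem_refHull {z : ℂ} (hz : z ∈ X.refHull.points) : z ∈ cone X.s 0 := by
  have h := hz.2.2
  simp only [refHull, sub_zero] at h
  exact mem_cone_zero.2 (h.trans_le (min_le_left _ _))

theorem eq_of_rot_mul_eq {i j : ℕ} (hi : i < X.s) (hj : j < X.s) {x y : ℂ}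
    (hx : x ∈ interior (cone X.s 0)) (hy : y ∈ cone X.s 0)
    (h : rot X.s i * x = rot X.s j * y) : i = j := by
  rcases (show X.s = 1 ∨ 2 ≤ X.s by omega) with hs | hs
  · omega
  refine _root_.eq_of_rot_mul_eq hi hj (interior_subset hx) hy h ?_
  rintro rfl
  simpa using im_pos_of_mem_interior_cone hs hx

namespace Admissible

theorem s_pos (hX : X.Admissible) : 0 < X.s := hX.centred.1

theorem tailStart_le (hX : X.Admissible) : X.tailStart ≤ X.k := by
  by_contra h
  have : X.covTail = ∅ := by
    rw [covTail, Set.Icc_eq_empty h]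
    simp
  simpa [this] using hX.covTail_card

theorem one_le_k (hX : X.Admissible) : 1 ≤ X.k := X.tailStart_mem.1.trans hX.tailStart_le

theorem enum_mem (hX : X.Admissible) {l i : ℕ} (hi : i ∈ Set.Icc 1 (X.numStates l)) :
    X.enum l i ∈ X.refHull.granularStatesOfSize X.ε l := (hX.enum_bij l).mapsTo hi

theorem three_mul_ε_le (hX : X.Admissible) : 3 * X.ε ≤ X.Δ := by
  have h1 : 1 ≤ X.numStates 3 := by
    have := hX.tail_le
    have := hX.tailStart_le
    omega
  obtain ⟨S, -, T, ⟨i, hi, -⟩, -⟩ := (hX.enum_mem (l := 3) ⟨le_rfl, h1⟩).1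
  have h2 := DrawingHull.mul_le_diam_of_mem_Icc hX.ε_pos hi
  have h3 : (1 : ℝ) ≤ i := by exact_mod_cast hi.1
  have h4 := hX.ε_pos
  change _ ≤ X.Δ at h2
  nlinarith

theorem φ_pos (hX : X.Admissible) : 0 < X.φ := by
  have := hX.s_pos
  rw [φ, lt_min_iff]
  exact ⟨by positivity, by positivity⟩

theorem closedBall_path_subset (hX : X.Admissible) {j : ℕ} (hj : j ∈ Set.Icc 1 X.k) :
    Metric.closedBall (X.v j) (max X.ε (X.Δ * Real.sin (2 * Real.pi / X.s))) ⊆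
      interior (cone X.s 0) :=
  closedBall_subset_interior (hX.ε_pos.le.trans (le_max_left _ _)) (hX.path_mem j hj)
    (hX.path_inside j hj)

theorem path_mem_interior (hX : X.Admissible) {j : ℕ} (hj : j ∈ Set.Icc 1 X.k) :
    X.v j ∈ interior (cone X.s 0) :=
  hX.closedBall_path_subset hj
    (Metric.mem_closedBall_self (hX.ε_pos.le.trans (le_max_left _ _)))

theorem rot_mul_mem (hX : X.Admissible) {i : ℕ} {p : ℂ} (hp : p ∈ X.P) : rot X.s i * p ∈ X.P := by
  induction i with
  | zero => simpa [rot_zero] using hp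
  | succ n ih =>
    rw [rot_succ, mul_assoc]
    simpa using hX.centred.2.2 _ ih

theorem lt_dist_droppedPart (hX : X.Admissible) {m : ℕ} {x y : ℂ} (hx : x ∈ X.droppedPart m)
    (hy : y ∈ X.droppedPart m) (hxy : x ≠ y) : X.ε < dist x y := by
  obtain ⟨i, -, p, hp, rfl⟩ := mem_droppedPart.1 hx
  obtain ⟨j, -, q, hq, rfl⟩ := mem_droppedPart.1 hy
  exact hX.ε_lt_mindist _ (hX.rot_mul_mem (dropSites_subset_comp m hp).1) _
    (hX.rot_mul_mem (dropSites_subset_comp m hq).1) hxy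

/-- Dropped robots are far from the current path vertex of their component. -/
theorem lt_dist_path (hX : X.Admissible) {m : ℕ}
    (hm : m ≤ X.k + 1) {p : ℂ} (hp : p ∈ X.dropSites m) :
    2 * X.Δ < dist p (X.v (min m X.k)) := by
  rw [dropSites, if_pos hm] at hp
  simp only [Set.mem_iUnion] at hp
  obtain ⟨j, hj, hp⟩ := hp
  have hτ := hX.tailStart_le
  have h1 : j < min m X.tailStart := hj.2
  have := hp.2.2 (min m X.k) ⟨by omega, min_le_right _ _⟩
  have := hX.δ_le
  linarith

theorem cluster_eq (hX : X.Admissible) (hst : X.StatesExist) {m : ℕ} (h1 : 1 ≤ m) (hm : m ≤ X.k) :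
    ∃ U ∈ X.refHull.granularStates X.ε, X.cluster m = (fun z => X.v m + z) '' U :=
  ⟨_, (hX.enum_mem (hst m ⟨h1, hm⟩)).1, by rw [cluster, if_pos hm]⟩

theorem state_subset (hX : X.Admissible) {U : Set ℂ} (hU : U ∈ X.refHull.granularStates X.ε) :
    U ⊆ X.refHull.granularLocations X.ε :=
  DrawingHull.subset_granularLocations (by simp [refHull]) hX.φ_pos hX.ε_pos hU

/-- The distances of the displaced robots of the intermediate shape from the end of the path. -/
theorem dist_displaced {v q : ℂ} (hq : q ≠ v) {r : ℝ} (hr : 0 ≤ r) :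
    dist (v + (r / ‖q - v‖ : ℝ) * (q - v)) v = r := by
  have hn : ‖q - v‖ ≠ 0 := norm_ne_zero_iff.2 (sub_ne_zero.2 hq)
  rw [dist_eq_norm, add_sub_cancel_left, norm_mul, Complex.norm_real, norm_div, norm_norm,
    Real.norm_of_nonneg hr, div_mul_cancel₀ _ hn]

theorem dist_interShape (hX : X.Admissible) {c : ℂ} (hc : c ∈ X.interShape) :
    dist c (X.v X.k) ≤ X.η := by
  have hη := hX.η_pos
  rcases hc with rfl | rfl | rfl
  · simpa using hη.le
  · exact (dist_displaced hX.p₂_ne hη.le).le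
  · rw [dist_displaced hX.p₃_ne (by positivity)]
    linarith

theorem dist_interShape_lt (hX : X.Admissible) {x y : ℂ} (hx : x ∈ X.interShape)
    (hy : y ∈ X.interShape) : dist x y < X.ε := by
  have hη := hX.η_pos
  have hε := hX.ε_pos
  have hle := hX.η_le
  have d2 := dist_displaced hX.p₂_ne hη.le
  have d3 := dist_displaced hX.p₃_ne (r := X.η / 3) (by positivity)
  have tri := dist_triangle_right x y (X.v X.k)
  rcases hx with rfl | rfl | rfl <;> rcases hy with rfl | rfl | rfl <;>
    first
    | simpa using hε
    | (simp only [d2, d3, dist_self] at tri; linarith)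

theorem exists_ne_interShape (hX : X.Admissible) {x : ℂ} (hx : x ∈ X.interShape) :
    ∃ y ∈ X.interShape, y ≠ x := by
  have hη := hX.η_pos
  have d2 := dist_displaced hX.p₂_ne hη.le
  have d3 := dist_displaced hX.p₃_ne (r := X.η / 3) (by positivity)
  rcases hx with rfl | rfl | rfl
  · exact ⟨_, Or.inr (Or.inl rfl), dist_pos.1 (d2.symm ▸ hη)⟩
  · exact ⟨_, Or.inl rfl, (dist_pos.1 (d2.symm ▸ hη)).symm⟩
  · exact ⟨_, Or.inl rfl, (dist_pos.1 (d3.symm ▸ by positivity)).symm⟩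

/-- Robots of a cluster are near the current path vertex. -/
theorem dist_cluster (hX : X.Admissible) (hst : X.StatesExist)
    {m : ℕ} (h1 : 1 ≤ m) {c : ℂ} (hc : c ∈ X.cluster m) :
    dist c (X.v (min m X.k)) ≤ X.Δ := by
  have hε := hX.three_mul_ε_le
  rcases lt_trichotomy m (X.k + 1) with h | rfl | h
  · obtain ⟨U, hU, e⟩ := hX.cluster_eq hst h1 (by omega)
    rw [e] at hc
    obtain ⟨z, hz, rfl⟩ := hc
    have := (hX.state_subset hU hz).2.1
    simpa [refHull, min_eq_left (show m ≤ X.k by omega)] using this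
  · rw [cluster_inter] at hc
    have := hX.dist_interShape hc
    have := hX.η_le
    have := hX.ε_pos
    rw [min_eq_right (Nat.le_succ _)]
    linarith
  · rw [cluster, if_neg (by omega), if_neg (by omega)] at hc
    exact hc.elim

theorem closedBall_cluster_subset (hX : X.Admissible) (hst : X.StatesExist)
    {m : ℕ} (h1 : 1 ≤ m) {c : ℂ}
    (hc : c ∈ X.cluster m) : Metric.closedBall c X.ε ⊆ interior (cone X.s 0) := by
  rcases lt_trichotomy m (X.k + 1) with h | rfl | h
  · obtain ⟨U, hU, e⟩ := hX.cluster_eq hst h1 (by omega)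
    rw [e] at hc
    obtain ⟨z, hz, rfl⟩ := hc
    intro y hy
    have hz := mem_cone_of_mem_refHull (hX.state_subset hU hz).2
    have hy' : y - z ∈ interior (cone X.s 0) := by
      refine hX.closedBall_path_subset (j := m) ⟨h1, by omega⟩ ?_
      refine Metric.closedBall_subset_closedBall (le_max_left _ _) ?_
      rw [Metric.mem_closedBall, dist_eq_norm] at hy ⊢
      convert hy using 2
      ring
    simpa using add_mem_interior_cone hX.s_pos hy' hz
  · rw [cluster_inter] at hc
    have := hX.dist_interShape hc
    have hη := hX.η_pos
    have hε := hX.ε_pos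
    refine (Metric.closedBall_subset_closedBall' ?_).trans
      (closedBall_subset_interior (r := X.ε + X.η) (by positivity)
        (hX.path_mem X.k ⟨hX.one_le_k, le_rfl⟩) hX.η_inside)
    linarith
  · rw [cluster, if_neg (by omega), if_neg (by omega)] at hc
    exact hc.elim

theorem cluster_subset_interior (hX : X.Admissible) (hst : X.StatesExist) {m : ℕ} (h1 : 1 ≤ m) :
    X.cluster m ⊆ interior (cone X.s 0) := fun _ hc =>
  hX.closedBall_cluster_subset hst h1 hc (Metric.mem_closedBall_self hX.ε_pos.le)

/-- The robots of a cluster are far from everything in the other cones. -/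
theorem lt_dist_of_ne (hX : X.Admissible) (hst : X.StatesExist) {m : ℕ} (h1 : 1 ≤ m) {c p : ℂ}
    (hc : c ∈ X.cluster m) (hp : p ∈ cone X.s 0) {i j : ℕ} (hi : i < X.s) (hj : j < X.s)
    (hij : i ≠ j) : X.ε < dist (rot X.s j * p) (rot X.s i * c) := by
  by_contra h
  push Not at h
  have hr := rot_ne_zero X.s i
  have e : rot X.s i * ((rot X.s i)⁻¹ * (rot X.s j * p)) = rot X.s j * p :=
    mul_inv_cancel_left₀ hr _
  rw [← e, dist_rot_mul] at h
  exact hij (eq_of_rot_mul_eq hi hj (hX.closedBall_cluster_subset hst h1 hc h) hp e)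

theorem lt_dist_dropSites_cluster (hX : X.Admissible) (hst : X.StatesExist)
    {m : ℕ} (h1 : 1 ≤ m) {p c : ℂ}
    (hp : p ∈ X.dropSites m) (hc : c ∈ X.cluster m) : X.ε < dist p c := by
  have hm : m ≤ X.k + 1 := by
    by_contra h
    rw [cluster, if_neg (by omega), if_neg (by omega)] at hc
    exact hc.elim
  have h2 := hX.lt_dist_path hm hp
  have h3 := hX.dist_cluster hst h1 hc
  have h4 := hX.three_mul_ε_le
  have h5 := hX.ε_pos
  have := dist_triangle p c (X.v (min m X.k))
  linarith

theorem lt_dist_dropped_cluster (hX : X.Admissible) (hst : X.StatesExist)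
    {m : ℕ} (h1 : 1 ≤ m) {x y : ℂ}
    (hx : x ∈ X.droppedPart m) (hy : y ∈ X.clusterPart m) : X.ε < dist x y := by
  obtain ⟨j, hj, p, hp, rfl⟩ := mem_droppedPart.1 hx
  obtain ⟨i, hi, c, hc, rfl⟩ := mem_clusterPart.1 hy
  rcases eq_or_ne i j with rfl | hij
  · rw [dist_rot_mul]
    exact hX.lt_dist_dropSites_cluster hst h1 hp hc
  · exact hX.lt_dist_of_ne hst h1 hc (dropSites_subset_comp m hp).2 hi hj hij

theorem disjoint_parts (hX : X.Admissible) (hst : X.StatesExist) {m : ℕ} (h1 : 1 ≤ m) :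
    Disjoint (X.droppedPart m) (X.clusterPart m) :=
  Set.disjoint_left.2 fun x hx hy => by
    have := hX.lt_dist_dropped_cluster hst h1 hx hy
    have := hX.ε_pos
    rw [dist_self] at *
    linarith

end Admissible

end DrawingProtocol

namespace DrawingProtocol

variable {X : DrawingProtocol}

theorem mem_points_hullAt {m i : ℕ} {x : ℂ} :
    x ∈ (X.hullAt m i).points ↔ ∃ z ∈ X.refHull.points, rot X.s i * (X.v m + z) = x := by
  rw [hullAt, DrawingHull.points_map (norm_rot _ _)]
  simp only [Set.mem_image]
  refine exists_congr fun z => and_congr_right fun _ => ?_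
  rw [mul_add, add_comm]

namespace Admissible

theorem path_add_mem_interior (hX : X.Admissible) {m : ℕ} (hm : m ∈ Set.Icc 1 X.k) {z : ℂ}
    (hz : z ∈ X.refHull.points) : X.v m + z ∈ interior (cone X.s 0) :=
  add_mem_interior_cone hX.s_pos (hX.path_mem_interior hm) (mem_cone_of_mem_refHull hz)

theorem disjoint_hullAt (hX : X.Admissible) {m i j : ℕ} (hm : m ∈ Set.Icc 1 X.k) (hi : i < X.s)
    (hj : j < X.s) (hij : i ≠ j) : Disjoint (X.hullAt m i).points (X.hullAt m j).points := by
  rw [Set.disjoint_left]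
  intro x hx hy
  obtain ⟨z, hz, rfl⟩ := mem_points_hullAt.1 hx
  obtain ⟨w, hw, h⟩ := mem_points_hullAt.1 hy
  exact hij (eq_of_rot_mul_eq hi hj (hX.path_add_mem_interior hm hz)
    (interior_subset (hX.path_add_mem_interior hm hw)) h.symm)

theorem mem_cone_of_mem_site (hX : X.Admissible) (hst : X.StatesExist) {m : ℕ} (h1 : 1 ≤ m)
    {p : ℂ} (hp : p ∈ X.dropSites m ∪ X.cluster m) : p ∈ cone X.s 0 :=
  hp.elim (fun h => (dropSites_subset_comp m h).2)
    fun h => interior_subset (hX.cluster_subset_interior hst h1 h)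

theorem config_inter_hullAt (hX : X.Admissible) (hst : X.StatesExist) {m i : ℕ}
    (hm : m ∈ Set.Icc 1 X.k) (hi : i < X.s) :
    X.config m ∩ (X.hullAt m i).points = (fun z => rot X.s i * z) '' X.cluster m := by
  obtain ⟨U, hU, e⟩ := hX.cluster_eq hst hm.1 hm.2
  ext x
  constructor
  · rintro ⟨hx, hxH⟩
    obtain ⟨z, hz, rfl⟩ := mem_points_hullAt.1 hxH
    simp only [config, Set.mem_iUnion] at hx
    obtain ⟨j, hj, p, hp, h⟩ := hx
    obtain rfl := eq_of_rot_mul_eq hi hj (hX.path_add_mem_interior hm hz)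
      (hX.mem_cone_of_mem_site hst hm.1 hp) h.symm
    obtain rfl := mul_left_cancel₀ (rot_ne_zero _ _) h
    refine Set.mem_image_of_mem _ (hp.resolve_left fun hp => ?_)
    have h1 := hX.lt_dist_path (hm.2.trans (Nat.le_succ _)) hp
    have h2 : dist z 0 ≤ X.Δ := hz.1
    have h3 := hX.diam_pos
    rw [min_eq_left hm.2, dist_eq_norm, add_sub_cancel_left] at h1
    rw [dist_zero_right] at h2
    linarith
  · rintro ⟨c, hc, rfl⟩
    refine ⟨?_, ?_⟩
    · rw [config_eq]
      exact Or.inr (mem_clusterPart.2 ⟨i, hi, c, hc, rfl⟩)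
    · rw [e] at hc
      obtain ⟨z, hz, rfl⟩ := hc
      exact mem_points_hullAt.2 ⟨z, (hX.state_subset hU hz).2, rfl⟩

theorem isGranular_hullAt (hX : X.Admissible) (hst : X.StatesExist) {m i : ℕ}
    (hm : m ∈ Set.Icc 1 X.k) (hi : i < X.s) :
    (X.hullAt m i).IsGranular X.ε X.Δ X.φ (X.config m) := by
  refine ⟨⟨by simp [hullAt, DrawingHull.map, refHull, norm_rot], ⟨hX.φ_pos, min_le_right _ _⟩,
    hX.diam_pos, ?_⟩, rfl, rfl, ?_⟩
  · have := hX.diam_le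
    change X.Δ ≤ 1
    linarith
  · obtain ⟨U, hU, e⟩ := hX.cluster_eq hst hm.1 hm.2
    rw [hX.config_inter_hullAt hst hm hi, e, Set.image_image, hullAt]
    convert DrawingHull.image_mem_granularStates (norm_rot X.s i) hU using 2
    ring

/-- At distance exactly `ε` there are only the anchors and their successors. -/
theorem eq_of_dist_eq (hX : X.Admissible) (hst : X.StatesExist) {m : ℕ} (h1 : 1 ≤ m) {x y : ℂ}
    (hx : x ∈ X.config m) (hy : y ∈ X.config m) (h : dist x y = X.ε) :
    m ≤ X.k ∧ ∃ i < X.s, (x = rot X.s i * X.v m ∧ y = rot X.s i * (X.v m + X.ε)) ∨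
      (x = rot X.s i * (X.v m + X.ε) ∧ y = rot X.s i * X.v m) := by
  have hε := hX.ε_pos
  have hne : x ≠ y := dist_pos.1 (h.symm ▸ hε)
  rw [config_eq] at hx hy
  rcases hx with hx | hx
  · rcases hy with hy | hy
    · exact absurd h (hX.lt_dist_droppedPart hx hy hne).ne'
    · exact absurd h (hX.lt_dist_dropped_cluster hst h1 hx hy).ne'
  rcases hy with hy | hy
  · rw [dist_comm] at h
    exact absurd h (hX.lt_dist_dropped_cluster hst h1 hy hx).ne'
  have hm : m ≤ X.k + 1 := by
    by_contra hc
    rw [clusterPart_eq_empty (by omega)] at hx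
    exact hx.elim
  obtain ⟨i, hi, c, hc, rfl⟩ := mem_clusterPart.1 hx
  obtain ⟨j, hj, d, hd, rfl⟩ := mem_clusterPart.1 hy
  rcases eq_or_ne j i with rfl | hij
  swap
  · exact absurd h (hX.lt_dist_of_ne hst h1 hd
      (interior_subset (hX.cluster_subset_interior hst h1 hc)) hj hi hij).ne'
  rw [dist_rot_mul] at h
  rcases hm.eq_or_lt with rfl | hm
  · rw [cluster_inter] at hc hd
    exact absurd h (hX.dist_interShape_lt hc hd).ne
  obtain ⟨U, hU, e⟩ := hX.cluster_eq hst h1 (by omega)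
  rw [e] at hc hd
  obtain ⟨z, hz, rfl⟩ := hc
  obtain ⟨w, hw, rfl⟩ := hd
  rw [dist_add_left] at h
  refine ⟨by omega, j, hj, ?_⟩
  rcases eq_or_eq_of_dist_eq hε rfl rfl (hX.state_subset hU hz) (hX.state_subset hU hw) h with
    ⟨rfl, rfl⟩ | ⟨rfl, rfl⟩
  · simp
  · simp

theorem granular_re_nonneg (hX : X.Admissible) {z : ℂ} (hz : z ∈ X.refHull.granularLocations X.ε) :
    0 ≤ z.re := by
  have hε := hX.ε_pos
  rcases hz.1 with rfl | ⟨i, j, rfl⟩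
  · simp [refHull]
  · simp [refHull]
    positivity

/-- The drawing formations of the components are the only granular ones. -/
theorem eq_hullAt_of_isGranular (hX : X.Admissible) (hst : X.StatesExist) {m : ℕ} (h1 : 1 ≤ m)
    {H : DrawingHull} (hH : H.IsGranular X.ε X.Δ X.φ (X.config m)) :
    m ≤ X.k ∧ ∃ i < X.s, H = X.hullAt m i := by
  have hε := hX.ε_pos
  have hεC : (X.ε : ℂ) ≠ 0 := by exact_mod_cast hε.ne'
  obtain ⟨n, hn, hnΔ, ha, hb, hc⟩ := hH.exists_defining hε
  have hd : dist H.anchor (H.anchor + X.ε * H.dir) = X.ε := by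
    rw [dist_self_add_right, norm_mul, hH.1.1, mul_one, Complex.norm_real,
      Real.norm_of_nonneg hε.le]
  obtain ⟨hm, i, hi, ⟨e1, e2⟩ | ⟨e1, e2⟩⟩ := hX.eq_of_dist_eq hst h1 ha hb hd
  · refine ⟨hm, i, hi, ?_⟩
    have hdir : H.dir = rot X.s i := by
      rw [e1] at e2
      apply mul_left_cancel₀ hεC
      linear_combination e2
    ext1
    · simp [hullAt, DrawingHull.map, refHull, e1]
    · simp [hullAt, DrawingHull.map, refHull, hdir]
    · exact hH.2.2.1
    · exact hH.2.1
  · exfalso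
    have hdir : H.dir = -rot X.s i := by
      rw [e1] at e2
      apply mul_left_cancel₀ hεC
      linear_combination e2
    have hn1 : (1 : ℝ) ≤ n := by exact_mod_cast hn
    set x : ℝ := 2 * n * X.ε with hx
    have hx0 : 0 < x := by positivity
    have hxΔ : x ≤ X.Δ := by linarith
    have hthird : H.anchor + ((1 + 2 * (n : ℝ)) * X.ε : ℝ) * H.dir =
        rot X.s i * (X.v m - x) := by
      rw [e1, hdir, hx]
      push_cast
      ring
    rw [hthird] at hc
    have hx2 : X.v m - x ∈ cone X.s 0 :=
      sub_ofReal_mem_cone hX.s_pos hx0.le hxΔ ((Metric.closedBall_subset_closedBall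
        (le_max_right _ _)).trans (hX.closedBall_path_subset ⟨h1, hm⟩))
        (hX.path_mem_interior ⟨h1, hm⟩)
    simp only [config, Set.mem_iUnion] at hc
    obtain ⟨j, hj, p, hp, h⟩ := hc
    have hpx : p = X.v m - x := by
      rcases (show X.s = 1 ∨ 2 ≤ X.s by omega) with hs | hs
      · have hij : j = i := by
          have : j < X.s := hj
          omega
        rw [hij] at h
        exact mul_left_cancel₀ (rot_ne_zero _ _) h
      · have hne : X.v m - x ≠ 0 := fun h0 => by
          have h2 := congrArg Complex.im h0
          have h3 := im_pos_of_mem_interior_cone hs (hX.path_mem_interior ⟨h1, hm⟩)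
          simp at h2
          linarith
        obtain rfl := _root_.eq_of_rot_mul_eq hi hj hx2
          (hX.mem_cone_of_mem_site hst h1 hp) h.symm hne
        exact mul_left_cancel₀ (rot_ne_zero _ _) h
    rcases hp with hp | hp
    · have h2 := hX.lt_dist_path (by omega) hp
      rw [min_eq_left hm, hpx, dist_eq_norm, sub_sub_cancel_left, norm_neg, Complex.norm_real,
        Real.norm_of_nonneg hx0.le] at h2
      linarith [hX.diam_pos]
    · obtain ⟨U, hU, e⟩ := hX.cluster_eq hst h1 hm
      rw [e] at hp
      obtain ⟨z, hz, hzp⟩ := hp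
      have h2 := hX.granular_re_nonneg (hX.state_subset hU hz)
      have h3 : z = -(x : ℂ) := by
        rw [← hzp] at hpx
        linear_combination hpx
      rw [h3] at h2
      simp at h2
      linarith

theorem isValid_of_isGranular (hX : X.Admissible) (hst : X.StatesExist) {m : ℕ} (h1 : 1 ≤ m)
    {u c : ℂ} (hu : ‖u‖ = 1) {H : DrawingHull}
    (hH : H.IsGranular X.ε X.Δ X.φ ((fun z => u * z + c) '' X.config m)) :
    H.IsValid X.ε X.Δ X.φ ((fun z => u * z + c) '' X.config m) := by
  refine ⟨hH, fun H' hH' hne => ?_⟩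
  obtain ⟨H, hG, rfl⟩ := hH.exists_of_image hu
  obtain ⟨H', hG', rfl⟩ := hH'.exists_of_image hu
  obtain ⟨hm, i, hi, rfl⟩ := hX.eq_hullAt_of_isGranular hst h1 hG
  obtain ⟨-, j, hj, rfl⟩ := hX.eq_hullAt_of_isGranular hst h1 hG'
  rw [DrawingHull.points_map hu, DrawingHull.points_map hu]
  refine Set.disjoint_image_of_injective (rigid_injective hu c)
    (hX.disjoint_hullAt ⟨h1, hm⟩ hi hj ?_)
  rintro rfl
  exact hne rfl

/-- The robots in drawing formations are those of the clusters before the intermediate shape. -/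
theorem exists_isGranular_iff (hX : X.Admissible) (hst : X.StatesExist) {m : ℕ} (h1 : 1 ≤ m)
    {u c : ℂ} (hu : ‖u‖ = 1) {x : ℂ} (hx : x ∈ X.config m) :
    (∃ H : DrawingHull, H.IsGranular X.ε X.Δ X.φ ((fun z => u * z + c) '' X.config m) ∧
      u * x + c ∈ H.points) ↔ m ≤ X.k ∧ x ∈ X.clusterPart m := by
  constructor
  · rintro ⟨H, hH, hxH⟩
    obtain ⟨H, hG, rfl⟩ := hH.exists_of_image hu
    rw [DrawingHull.mem_points_map hu] at hxH
    obtain ⟨hm, i, hi, rfl⟩ := hX.eq_hullAt_of_isGranular hst h1 hG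
    have : x ∈ X.config m ∩ (X.hullAt m i).points := ⟨hx, hxH⟩
    rw [hX.config_inter_hullAt hst ⟨h1, hm⟩ hi] at this
    obtain ⟨p, hp, rfl⟩ := this
    exact ⟨hm, mem_clusterPart.2 ⟨i, hi, p, hp, rfl⟩⟩
  · rintro ⟨hm, hxc⟩
    obtain ⟨i, hi, p, hp, rfl⟩ := mem_clusterPart.1 hxc
    refine ⟨_, (hX.isGranular_hullAt hst ⟨h1, hm⟩ hi).map hu,
      (DrawingHull.mem_points_map hu).2 ?_⟩
    have : rot X.s i * p ∈ X.config m ∩ (X.hullAt m i).points := by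
      rw [hX.config_inter_hullAt hst ⟨h1, hm⟩ hi]
      exact ⟨p, hp, rfl⟩
    exact this.2

end Admissible

end DrawingProtocol

namespace DrawingProtocol

namespace Execution

variable {X : DrawingProtocol} (E : X.Execution)

/-- Robot `r` is in the cluster of its component at time `t`. -/
def InCluster (t : ℕ) (r : Fin X.P.card) : Prop :=
  E.T ≤ t ∧ ∃ x ∈ X.clusterPart (t - E.T + 1), E.u * x + E.c = E.pos t r

/-- Robot `r` is at time `t` on one of the coordinates on which robots have been dropped. -/
def OnDropSite (t : ℕ) (r : Fin X.P.card) : Prop :=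
  E.T ≤ t ∧ ∃ x ∈ X.droppedPart (t - E.T + 1), E.u * x + E.c = E.pos t r

variable {E} {t : ℕ} {r : Fin X.P.card}

theorem range_pos (ht : E.T ≤ t) :
    Set.range (E.pos t) = (fun z => E.u * z + E.c) '' X.config (t - E.T + 1) := by
  have := E.run (t - E.T)
  rwa [Nat.add_sub_cancel' ht] at this

theorem exists_config (ht : E.T ≤ t) (r : Fin X.P.card) :
    ∃ x ∈ X.config (t - E.T + 1), E.u * x + E.c = E.pos t r := by
  have : E.pos t r ∈ Set.range (E.pos t) := ⟨r, rfl⟩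
  rwa [range_pos ht] at this

theorem exists_robot (ht : E.T ≤ t) {x : ℂ} (hx : x ∈ X.config (t - E.T + 1)) :
    ∃ r, E.pos t r = E.u * x + E.c := by
  have : E.u * x + E.c ∈ Set.range (E.pos t) := by
    rw [range_pos ht]
    exact ⟨x, hx, rfl⟩
  exact this

theorem onDropSite_or_inCluster (ht : E.T ≤ t) (r : Fin X.P.card) :
    E.OnDropSite t r ∨ E.InCluster t r := by
  obtain ⟨x, hx, h⟩ := exists_config ht r
  rw [config_eq] at hx
  exact hx.imp (fun hx => ⟨ht, x, hx, h⟩) fun hx => ⟨ht, x, hx, h⟩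

theorem OnDropSite.not_inCluster (hX : X.Admissible) (h : E.OnDropSite t r) :
    ¬ E.InCluster t r := by
  rintro ⟨-, y, hy, e⟩
  obtain ⟨-, x, hx, rfl⟩ : E.T ≤ t ∧ ∃ x ∈ X.droppedPart (t - E.T + 1), x = y := by
    obtain ⟨ht, x, hx, e'⟩ := h
    exact ⟨ht, x, hx, rigid_injective E.norm_u E.c (e'.trans e.symm)⟩
  exact Set.disjoint_left.1 (hX.disjoint_parts E.state_exists (by omega)) hx hy

theorem InCluster.le (h : E.InCluster t r) : t ≤ E.T + X.k := by
  obtain ⟨ht, x, hx, -⟩ := h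
  by_contra hc
  rw [clusterPart_eq_empty (by omega)] at hx
  exact hx.elim

theorem inDrawing_iff (hX : X.Admissible) :
    E.InDrawing t r ↔ E.InCluster t r ∧ t < E.T + X.k := by
  by_cases ht : E.T ≤ t
  swap
  · exact ⟨fun h => absurd h.1 ht, fun h => absurd h.1.1 ht⟩
  obtain ⟨x, hx, h⟩ := exists_config ht r
  have key := hX.exists_isGranular_iff E.state_exists (by omega) (c := E.c) E.norm_u hx
  rw [InDrawing, range_pos ht, ← h]
  constructor
  · rintro ⟨-, H, hH, hr⟩
    obtain ⟨hm, hx⟩ := key.1 ⟨H, hH.1, hr⟩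
    exact ⟨⟨ht, x, hx, h⟩, by omega⟩
  · rintro ⟨⟨-, y, hy, h'⟩, hm⟩
    obtain rfl := rigid_injective E.norm_u E.c (h'.trans h.symm)
    obtain ⟨H, hH, hr⟩ := key.2 ⟨by omega, hy⟩
    exact ⟨ht, H, hX.isValid_of_isGranular E.state_exists (by omega) E.norm_u hH, hr⟩

theorem inIntermediate_iff : E.InIntermediate t r ↔ E.InCluster t r ∧ t = E.T + X.k := by
  rw [and_comm, InIntermediate]
  refine and_congr_right ?_
  rintro rfl
  simp only [InCluster, mem_clusterPart, Nat.add_sub_cancel_left, cluster_inter, Nat.le_add_right,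
    true_and]
  constructor
  · rintro ⟨i, hi, z, hz, h⟩
    exact ⟨_, ⟨i, hi, z, hz, rfl⟩, h⟩
  · rintro ⟨_, ⟨i, hi, z, hz, rfl⟩, h⟩
    exact ⟨i, hi, z, hz, h⟩

theorem inDrawing_or_inIntermediate_iff (hX : X.Admissible) :
    E.InDrawing t r ∨ E.InIntermediate t r ↔ E.InCluster t r := by
  rw [inDrawing_iff hX, inIntermediate_iff, ← and_or_left]
  exact and_iff_left_of_imp fun h => h.le.lt_or_eq

theorem OnDropSite.succ (h : E.OnDropSite t r) : E.OnDropSite (t + 1) r := by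
  obtain ⟨ht, x, hx, e⟩ := h
  refine ⟨by omega, x, ?_, ?_⟩
  · rw [show t + 1 - E.T + 1 = t - E.T + 1 + 1 by omega]
    exact droppedPart_mono_succ _ hx
  · obtain ⟨i, hi, p, hp, rfl⟩ := mem_droppedPart.1 hx
    have := E.idle (t - E.T) r i hi
    rw [Nat.add_sub_cancel' ht] at this
    rw [this ⟨p, hp, e⟩, e]

theorem inCluster_start (r : Fin X.P.card) : E.InCluster E.T r := by
  refine (onDropSite_or_inCluster le_rfl r).resolve_left ?_
  rintro ⟨-, x, hx, -⟩
  rw [Nat.sub_self, zero_add, droppedPart_one] at hx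
  exact hx

theorem isDropped_iff (hX : X.Admissible) : E.IsDropped t r ↔ E.OnDropSite t r := by
  simp only [IsDropped, inDrawing_or_inIntermediate_iff hX]
  constructor
  · rintro ⟨t', ht', h1, h2⟩
    have h3 : E.OnDropSite (t' + 1) r :=
      (onDropSite_or_inCluster (h1.1.trans (Nat.le_succ _)) r).resolve_right h2
    exact Nat.le_induction h3 (fun _ _ h => h.succ) t ht'
  · intro h
    by_contra hc
    push Not at hc
    refine h.not_inCluster hX ?_
    have : ∀ n, E.T ≤ n → n ≤ t → E.InCluster n r := fun n hn =>
      Nat.le_induction (fun _ => inCluster_start r)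
        (fun n _ ih hle => hc n hle (ih (by omega))) n hn
    exact this t h.1 le_rfl

theorem snapshot_eq {w : ℂ} (hw : ‖w‖ = 1) :
    E.snapshot t r w = (fun z => w * z + -(w * E.pos t r)) '' Set.range (E.pos t) ∩
      Metric.closedBall 0 1 := by
  ext z
  have hn : ∀ r', ‖w * E.pos t r' + -(w * E.pos t r)‖ = dist (E.pos t r') (E.pos t r) :=
    fun r' => by rw [← sub_eq_add_neg, ← mul_sub, norm_mul, hw, one_mul, dist_eq_norm]
  constructor
  · rintro ⟨r', hr', rfl⟩
    refine ⟨⟨_, ⟨r', rfl⟩, by ring⟩, ?_⟩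
    rw [mem_closedBall_zero_iff, mul_sub, sub_eq_add_neg, hn]
    exact hr'
  · rintro ⟨⟨_, ⟨r', rfl⟩, rfl⟩, h⟩
    rw [mem_closedBall_zero_iff, hn] at h
    exact ⟨r', h, by ring⟩

theorem ncard_image_range {w c : ℂ} (hw : ‖w‖ = 1) :
    ((fun z => w * z + c) '' Set.range (E.pos t)).ncard = X.P.card := by
  rw [Set.ncard_image_of_injective _ (rigid_injective hw c), ← Set.image_univ,
    Set.ncard_image_of_injective _ (E.injective t), Set.ncard_univ, Nat.card_fin]

theorem finite_image_range {w c : ℂ} :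
    ((fun z => w * z + c) '' Set.range (E.pos t)).Finite :=
  (Set.finite_range _).image _

theorem image_range_eq (ht : E.T ≤ t) (w c : ℂ) :
    (fun z => w * z + c) '' Set.range (E.pos t) =
      (fun z => w * E.u * z + (w * E.c + c)) '' X.config (t - E.T + 1) := by
  rw [range_pos ht, Set.image_image]
  refine Set.image_congr fun z _ => ?_
  ring

/-- Before the initial drawing pattern is formed, and only then, a robot sees all robots, in a
configuration that is not one of the stages. -/
theorem snapshot_initial_iff {w : ℂ} (hw : ‖w‖ = 1) :
    ((E.snapshot t r w).ncard = X.P.card ∧ ∀ m, 1 ≤ m → ∀ u c : ℂ, ‖u‖ = 1 →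
      E.snapshot t r w ≠ (fun z => u * z + c) '' X.config m) ↔ t < E.T := by
  constructor
  · rintro ⟨h1, h2⟩
    by_contra ht
    push Not at ht
    have heq : E.snapshot t r w = (fun z => w * z + -(w * E.pos t r)) '' Set.range (E.pos t) := by
      refine Set.eq_of_subset_of_ncard_le ?_ ?_ finite_image_range
      · rw [snapshot_eq hw]
        exact Set.inter_subset_left
      · rw [h1, ncard_image_range hw]
    rw [image_range_eq ht] at heq
    exact h2 _ (by omega) _ _ (by rw [norm_mul, hw, E.norm_u, one_mul]) heq
  · intro ht
    have heq : E.snapshot t r w = (fun z => w * z + -(w * E.pos t r)) '' Set.range (E.pos t) := by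
      rw [snapshot_eq hw, Set.inter_eq_left]
      rintro _ ⟨_, ⟨r', rfl⟩, rfl⟩
      have := E.near t ht r' r
      rw [mem_closedBall_zero_iff]
      beta_reduce
      rwa [← sub_eq_add_neg, ← mul_sub, norm_mul, hw, one_mul,
        ← dist_eq_norm]
    refine ⟨by rw [heq, ncard_image_range hw], fun m hm u c hu h => ?_⟩
    have hw0 := ne_zero_of_norm_eq_one hw
    refine E.fresh t ht m hm (w⁻¹ * u) (w⁻¹ * c + E.pos t r) (by simp [hw, hu]) ?_
    rw [heq] at h
    have h' := congrArg (fun S => (fun z => w⁻¹ * z + E.pos t r) '' S) h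
    simp only [Set.image_image] at h'
    convert h' using 1
    · conv_lhs => rw [← Set.image_id (Set.range (E.pos t))]
      refine Set.image_congr fun z _ => ?_
      simp only [id]
      field_simp
      ring
    · refine Set.image_congr fun z _ => ?_
      ring

theorem snapshot_drawing_iff (hX : X.Admissible) (ht : E.T ≤ t) {w : ℂ} (hw : ‖w‖ = 1) :
    (∃ H : DrawingHull, H.IsGranular X.ε X.Δ X.φ (E.snapshot t r w) ∧ 0 ∈ H.points) ↔
      E.InDrawing t r := by
  rw [inDrawing_iff hX]
  obtain ⟨x, hx, h⟩ := exists_config ht r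
  have hwu : ‖w * E.u‖ = 1 := by rw [norm_mul, hw, E.norm_u, one_mul]
  have key := hX.exists_isGranular_iff E.state_exists (by omega)
    (c := w * E.c + -(w * E.pos t r)) hwu hx
  rw [← image_range_eq ht, show w * E.u * x + (w * E.c + -(w * E.pos t r)) = 0 by
    rw [← h]; ring] at key
  have hloc : ∀ H : DrawingHull, H.diam = X.Δ → 0 ∈ H.points → E.snapshot t r w ∩ H.points =
      (fun z => w * z + -(w * E.pos t r)) '' Set.range (E.pos t) ∩ H.points := by
    intro H hH h0
    rw [snapshot_eq hw, Set.inter_assoc]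
    congr 1
    refine Set.inter_eq_right.2 fun y hy => ?_
    have h1 := DrawingHull.dist_le_of_mem_points hy h0
    rw [Metric.mem_closedBall]
    linarith [hX.diam_le]
  have hgr : (∃ H : DrawingHull, H.IsGranular X.ε X.Δ X.φ (E.snapshot t r w) ∧ 0 ∈ H.points) ↔
      t - E.T + 1 ≤ X.k ∧ x ∈ X.clusterPart (t - E.T + 1) := by
    rw [← key]
    refine exists_congr fun H => and_congr_left fun h0 => ?_
    exact ⟨fun hH => hH.congr (hloc H hH.2.1 h0).symm, fun hH => hH.congr (hloc H hH.2.1 h0)⟩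
  rw [hgr]
  constructor
  · rintro ⟨h1, h2⟩
    exact ⟨⟨ht, x, h2, h⟩, by omega⟩
  · rintro ⟨⟨-, y, hy, h'⟩, h1⟩
    obtain rfl := rigid_injective E.norm_u E.c (h'.trans h.symm)
    exact ⟨by omega, hy⟩

theorem snapshot_close_iff (hX : X.Admissible) {w : ℂ} (hw : ‖w‖ = 1) :
    (∃ z ∈ E.snapshot t r w, z ≠ 0 ∧ ‖z‖ ≤ X.ε) ↔
      ∃ r', E.pos t r' ≠ E.pos t r ∧ dist (E.pos t r') (E.pos t r) ≤ X.ε := by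
  have hn : ∀ r', ‖w * (E.pos t r' - E.pos t r)‖ = dist (E.pos t r') (E.pos t r) :=
    fun r' => by rw [norm_mul, hw, one_mul, dist_eq_norm]
  constructor
  · rintro ⟨_, ⟨r', -, rfl⟩, h0, h1⟩
    refine ⟨r', fun h => h0 (by rw [h, sub_self, mul_zero]), ?_⟩
    rwa [hn] at h1
  · rintro ⟨r', h0, h1⟩
    have h2 := hX.three_mul_ε_le
    have h3 := hX.diam_le
    have h4 := hX.ε_pos
    exact ⟨_, ⟨r', by linarith, rfl⟩,
      mul_ne_zero (ne_zero_of_norm_eq_one hw) (sub_ne_zero.2 h0), by rwa [hn]⟩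

theorem InIntermediate.exists_close (hX : X.Admissible) (h : E.InIntermediate t r) :
    ∃ r', E.pos t r' ≠ E.pos t r ∧ dist (E.pos t r') (E.pos t r) ≤ X.ε := by
  obtain ⟨rfl, i, hi, z, hz, h⟩ := h
  obtain ⟨y, hy, hne⟩ := hX.exists_ne_interShape hz
  have hyc : rot X.s i * y ∈ X.config (E.T + X.k - E.T + 1) := by
    rw [config_eq]
    refine Or.inr (mem_clusterPart.2 ⟨i, hi, y, ?_, rfl⟩)
    rwa [Nat.add_sub_cancel_left, cluster_inter]
  obtain ⟨r', hr'⟩ := exists_robot (by omega) hyc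
  have hd : dist (E.pos (E.T + X.k) r') (E.pos (E.T + X.k) r) = dist y z := by
    rw [hr', ← h, dist_rigid E.norm_u, dist_rot_mul]
  refine ⟨r', ?_, ?_⟩
  · rw [← dist_pos, hd]
    exact dist_pos.2 hne
  · rw [hd]
    exact (hX.dist_interShape_lt hy hz).le

theorem OnDropSite.lt_dist (hX : X.Admissible) (h : E.OnDropSite t r) {r' : Fin X.P.card}
    (hne : E.pos t r' ≠ E.pos t r) : X.ε < dist (E.pos t r') (E.pos t r) := by
  obtain ⟨ht, x, hx, e⟩ := h
  obtain ⟨y, hy, e'⟩ := exists_config ht r'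
  rw [← e, ← e', dist_rigid E.norm_u, dist_comm]
  rw [config_eq] at hy
  rcases hy with hy | hy
  · refine hX.lt_dist_droppedPart hx hy ?_
    rintro rfl
    exact hne (e'.symm.trans e)
  · exact hX.lt_dist_dropped_cluster E.state_exists (by omega) hx hy

end Execution

open Classical in
/-- The situation of a robot, as read off from its snapshot: initial if all robots are visible in
a configuration that is not one of the stages; otherwise drawing if it lies in a visible granular
formation; otherwise intermediate or dropped, according to the presence of another robot at
distance at most `ε`. -/
noncomputable def classify (X : DrawingProtocol) (S : Set ℂ) : Situation :=
  if S.ncard = X.P.card ∧ ∀ m, 1 ≤ m → ∀ u c : ℂ, ‖u‖ = 1 →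
      S ≠ (fun z => u * z + c) '' X.config m then .initial
  else if ∃ H : DrawingHull, H.IsGranular X.ε X.Δ X.φ S ∧ 0 ∈ H.points then .drawing
  else if ∃ z ∈ S, z ≠ 0 ∧ ‖z‖ ≤ X.ε then .intermediate
  else .dropped

open Execution in
theorem classify_snapshot_iff {X : DrawingProtocol} (hX : X.Admissible) (E : X.Execution) (t : ℕ)
    (r : Fin X.P.card) {w : ℂ} (hw : ‖w‖ = 1) (σ : Situation) :
    X.classify (E.snapshot t r w) = σ ↔ E.InSituation t r σ := by
  rw [classify]
  simp only [E.snapshot_initial_iff hw, snapshot_close_iff hX hw]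
  by_cases ht : t < E.T
  · have hc : ¬ E.InCluster t r := fun h => absurd h.1 (by omega)
    have hd : ¬ E.OnDropSite t r := fun h => absurd h.1 (by omega)
    rw [if_pos ht]
    cases σ <;> simp [InSituation,
      inDrawing_iff hX, inIntermediate_iff,
      isDropped_iff hX, InInitial, ht, hc, hd]
  have hT : E.T ≤ t := by omega
  have hS := snapshot_drawing_iff hX hT hw (r := r)
  rw [if_neg ht]
  by_cases hD : E.OnDropSite t r
  · have hc := hD.not_inCluster hX
    have hdr : ¬ E.InDrawing t r := by
      simp [inDrawing_iff hX, hc]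
    rw [if_neg (mt hS.1 hdr), if_neg (by
      rintro ⟨r', h1, h2⟩
      exact absurd (hD.lt_dist hX h1) h2.not_gt)]
    cases σ <;> simp [InSituation, hdr,
      inIntermediate_iff,
      isDropped_iff hX, InInitial, ht, hc, hD]
  · have hc := (onDropSite_or_inCluster hT r).resolve_left hD
    by_cases hk : t < E.T + X.k
    · have hdr : E.InDrawing t r := (inDrawing_iff hX).2 ⟨hc, hk⟩
      rw [if_pos (hS.2 hdr)]
      cases σ <;> simp [InSituation, hdr,
        inIntermediate_iff,
        isDropped_iff hX, InInitial, ht, hD,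
        hk.ne]
    · have hdr : ¬ E.InDrawing t r := fun h =>
        hk ((inDrawing_iff hX).1 h).2
      have hi : E.InIntermediate t r := inIntermediate_iff.2
        ⟨hc, le_antisymm hc.le (by omega)⟩
      rw [if_neg (mt hS.1 hdr), if_pos (hi.exists_close hX)]
      cases σ <;> simp [InSituation, hdr, hi,
        isDropped_iff hX, InInitial, ht, hD]

end DrawingProtocol

theorem mainTheorem7 (X : DrawingProtocol) (hX : X.Admissible) :
    ∃ classify : Set ℂ → Situation,
      ∀ (E : X.Execution) (t : ℕ) (r : Fin X.P.card) (w : ℂ), ‖w‖ = 1 →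
        ∀ σ : Situation, classify (E.snapshot t r w) = σ ↔ E.InSituation t r σ := by
  exact ⟨X.classify, fun E t r _ hw => DrawingProtocol.classify_snapshot_iff hX E t r hw⟩
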